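/- Fix $\beta>0$, $m>0$, $\theta\in(0,1)$, $\delta_*>0$ and put $\rho_*=\rho_*(\theta,\delta_*)=\frac{1-\theta}{\sqrt{\theta(1+\theta)\delta_*}}$. For $k,k'\ge 0$, not both zero, let $$\mathcal B_\beta(k,k')=\sqrt\beta\,e^{\beta\frac{k+k'}2}\int_{-1}^{1}\frac{1+t^2}{d}\,e^{-\beta\frac{(k'-k)^2+\frac{m^2w^4}{4}}{2mw^2}}\,dt,\qquad d=\sqrt{k^2+k'^2-2kk't},\quad w=\frac dm .$$ For $\vartheta\in(0,1)$ and $\rho>0$ let $D(\vartheta,\rho)$ be the set of $(k,k')\in[0,\infty)^2$ such that $|k-k'|\le\rho\sqrt{kk'(k+k')}$ if $(k,k')\in[0,\delta_*]^2$, and $\vartheta k\le k'\le\vartheta^{-1}k$ if $(k,k')\notin[0,\delta_*]^2$. Let $\Phi:[0,\infty)^2\to[0,1]$ be symmetric on $(0,\infty)^2$, continuous on $[0,\infty)^2\setminus\{(0,0)\}$, with $\operatorname{supp}\Phi=D:=D(\theta,\rho_*)$, and with $\Phi=1$ on $D(\theta_1,\rho_1)$ for some $\theta_1\in(\theta,1)$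 and $\rho_1>0$. Put $B=\Phi\mathcal B_\beta$ and $R(k,k')=(e^{-\beta k}-e^{-\beta k'})\frac{B(k,k')}{kk'}$. Call $C_*>0$ admissible if, for all $(k,k')\in D\setminus\{(0,0)\}$, $$B(k,k')\le B\left(\tfrac{k+k'}2,\tfrac{k+k'}2\right)\le \frac{C_*\,e^{\beta\frac{k+k'}2}}{k+k'} .$$ **Theorem.** An admissible $C_*$ exists. Let $v_0\in L^1([0,\infty))$ be nonnegative and let $\eta>\beta\frac{1-\theta}2$ be such that $$\forall r>0,\qquad \int_0^\infty v_0(k)\left(e^{r/k^{3/2}}+e^{\eta k}\right)dk<\infty .$$ Then there exists a nonnegative $v\in C([0,\infty),L^1([0,\infty)))$ with $v(0)=v_0$ with the following properties. 1. $v$ is a global weak solution of $\ \partial_tv(t,k)=v(t,k)\int_0^\infty R(k,k')v(t,k')\,dk'\ $ with initial datum $v_0$. That is, for every $\varphi\in C_b([0,\infty))$ the function $t\mapsto\int_0^\infty v(t,k)\varphi(k)\,dk$ is continuous on $[0,\infty)$ with value $\int_0^\infty v_0\varphi$ at $t=0$; and for every $\varphi\in C^1_b([0,\infty))$ with $\varphi'(0)=0$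 it belongs to $W^{1,\infty}_{loc}([0,\infty))$ and, for a.e. $t>0$, $$\frac{d}{dt}\int_0^\infty v(t,k)\varphi(k)\,dk=\frac12\iint_{(0,\infty)^2}R(k,k')\,v(t,k)\,v(t,k')\,(\varphi(k)-\varphi(k'))\,dk\,dk',$$ the double integral being absolutely convergent. 2. For all $t>0$ and a.e. $k>0$, $\ v(t,k)=v_0(k)\exp\left(\int_0^t\int_0^\infty R(k,k')\,v(s,k')\,dk'\,ds\right)$, where the integrals converge. 3. For all $t>0$, $\ \|v(t)\|_1=\|v_0\|_1$. 4. For every admissible $C_*$, all $t>0$ and a.e. $k>0$, $\ v(t,k)\le v_0(k)\,e^{tC_0/k^{3/2}}$, where $$C_0=\beta\,\frac{\rho_*C_*}{\sqrt{\theta(1+\theta)}}\int_0^\infty e^{\eta k}v_0(k)\,dk .$$ (In particular no Dirac mass forms at the origin in finite time. For $\beta=1$ the condition on $\eta$ is $\eta>\frac{1-\theta}2$ and $C_0=\frac{\rho_*C_*}{\sqrt{\theta(1+\theta)}}\int_0^\infty e^{\eta k}v_0(k)\,dk$.) -/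

import Mathlib

open MeasureTheory Set

namespace Compton

noncomputable section

/-- Lebesgue measure on the half line of photon energies (the point `0` is a null set). -/
abbrev halfLine : Measure ℝ := volume.restrict (Ioi (0 : ℝ))

/-- The space `L¹([0, ∞))` of classes of real integrable functions. -/
abbrev L1 : Type := Lp ℝ 1 halfLine

/-- The distance `|𝐤' - 𝐤|` of two momenta of lengths `k`, `k'` whose angle has cosine `t`. -/
def momentumTransfer (k k' t : ℝ) : ℝ := √(k ^ 2 + k' ^ 2 - 2 * k * k' * t)

/-- The redistribution function `𝓑_β` for electrons of mass `m`, the angular variable being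
`t = cos ϑ ∈ [-1, 1]`; here `v = |𝐤' - 𝐤| / m` and `Δ = k' - k`. -/
def redistribution (β m k k' : ℝ) : ℝ :=
  √β * Real.exp (β * (k' + k) / 2) *
    ∫ t in (-1 : ℝ)..1,
      (1 + t ^ 2) / momentumTransfer k k' t *
        Real.exp (-β * (((k' - k) ^ 2 + m ^ 2 * (momentumTransfer k k' t / m) ^ 4 / 4) /
          (2 * m * (momentumTransfer k k' t / m) ^ 2)))

/-- The region of pairs of energies `(k, k') ∈ [0, ∞)²` with `|k - k'| ≤ ρ √(k k' (k + k'))` inside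
the square `[0, δ]²`, and `θ k ≤ k' ≤ θ⁻¹ k` outside that square. -/
def region (θ δ ρ : ℝ) : Set (ℝ × ℝ) :=
  {p | (p ∈ Icc 0 δ ×ˢ Icc 0 δ ∧ |p.1 - p.2| ≤ ρ * √(p.1 * p.2 * (p.1 + p.2))) ∨
       (p ∈ (Ici 0 ×ˢ Ici 0) \ (Icc 0 δ ×ˢ Icc 0 δ) ∧ θ * p.1 ≤ p.2 ∧ p.2 ≤ θ⁻¹ * p.1)}

/-- The value `ρ_*(θ, δ)` of `ρ` for which the two boundary curves of `region θ δ ρ` are continuous: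
the curve `|k - k'| = ρ √(k k' (k + k'))` meets the ray `k' = θ k` at `(δ, θ δ)`. -/
def rhoStar (θ δ : ℝ) : ℝ := (1 - θ) / √(θ * (1 + θ) * δ)

/-- `Φ` is an admissible cut off function with parameters `θ` and `δ`. The values of `Φ` matter on
`[0, ∞)²` only. -/
structure IsCutoff (θ δ : ℝ) (Φ : ℝ → ℝ → ℝ) : Prop where
  symm : ∀ k > 0, ∀ k' > 0, Φ k k' = Φ k' k
  continuousOn : ContinuousOn (fun p : ℝ × ℝ => Φ p.1 p.2) ((Ici 0 ×ˢ Ici 0) \ {(0, 0)})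
  mem_Icc : ∀ k ≥ 0, ∀ k' ≥ 0, Φ k k' ∈ Icc (0 : ℝ) 1
  support_eq : closure {p : ℝ × ℝ | p ∈ Ici 0 ×ˢ Ici 0 ∧ Φ p.1 p.2 ≠ 0} =
    region θ δ (rhoStar θ δ)
  eq_one : ∃ θ₁ ∈ Ioo θ 1, ∃ ρ₁ > 0, ∀ p ∈ region θ₁ δ ρ₁, Φ p.1 p.2 = 1

/-- The truncated redistribution function `Φ 𝓑_β`. -/
def truncated (β m : ℝ) (Φ : ℝ → ℝ → ℝ) (k k' : ℝ) : ℝ := Φ k k' * redistribution β m k k'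

/-- The antisymmetric kernel `(e^{-β k} - e^{-β k'}) 𝓑_β(k, k') Φ(k, k') / (k k')`. -/
def R (β m : ℝ) (Φ : ℝ → ℝ → ℝ) (k k' : ℝ) : ℝ :=
  (Real.exp (-β * k) - Real.exp (-β * k')) * (truncated β m Φ k k' / (k * k'))

/-- `C` is an admissible constant `C_*` in the bound of the truncated redistribution function on its
support. -/
def IsKernelConstant (β m θ δ : ℝ) (Φ : ℝ → ℝ → ℝ) (C : ℝ) : Prop :=
  0 < C ∧ ∀ k k' : ℝ, (k, k') ∈ region θ δ (rhoStar θ δ) → (k, k') ≠ (0, 0) →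
    truncated β m Φ k k' ≤ truncated β m Φ ((k + k') / 2) ((k + k') / 2) ∧
    truncated β m Φ ((k + k') / 2) ((k + k') / 2) ≤ C * Real.exp (β * (k + k') / 2) / (k + k')

/-- The exponential moment `X_η(w) = ∫ e^{η k} w(k) dk`. -/
def expMoment (η : ℝ) (w : L1) : ℝ := ∫ k, Real.exp (η * k) * w k ∂halfLine

/-- `φ ∈ C_b([0, ∞))`. -/
def IsCb (φ : ℝ → ℝ) : Prop :=
  ContinuousOn φ (Ici 0) ∧ ∃ M, ∀ k ≥ 0, |φ k| ≤ M

/-- `φ ∈ C¹_b([0, ∞))`: bounded, with a continuous and bounded derivative. -/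
def IsC1b (φ : ℝ → ℝ) : Prop :=
  ContDiffOn ℝ 1 φ (Ici 0) ∧ (∃ M, ∀ k ≥ 0, |φ k| ≤ M) ∧
    ∃ M, ∀ k ≥ 0, |derivWithin φ (Ici 0) k| ≤ M

/-- The pairing `∫ v(t, k) φ(k) dk`, as a function of `t`. -/
def pairing (v : ℝ → L1) (φ : ℝ → ℝ) (t : ℝ) : ℝ := ∫ k, v t k * φ k ∂halfLine

/-- The integrand `R(k, k') v(t, k) v(t, k') (φ(k) - φ(k'))` of the weak collision operator. -/
def weakIntegrand (β m : ℝ) (Φ : ℝ → ℝ → ℝ) (w : L1) (φ : ℝ → ℝ) (p : ℝ × ℝ) : ℝ :=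
  R β m Φ p.1 p.2 * w p.1 * w p.2 * (φ p.1 - φ p.2)

/-- `v : [0, ∞) → L¹([0, ∞))` is a weak solution, with initial datum `v₀`, of
`∂v/∂t (t, k) = v(t, k) ∫ v(t, k') R(k, k') dk'`. A function of `t ∈ [0, ∞)` is in
`W^{1,∞}_loc([0, ∞))` when it is Lipschitz on every `[0, T]`. -/
structure IsWeakSolution (β m : ℝ) (Φ : ℝ → ℝ → ℝ) (v₀ : L1) (v : ℝ → L1) : Prop where
  continuousOn : ∀ φ, IsCb φ → ContinuousOn (pairing v φ) (Ici 0)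
  initial : ∀ φ, IsCb φ → pairing v φ 0 = ∫ k, v₀ k * φ k ∂halfLine
  lipschitz : ∀ φ, IsC1b φ → derivWithin φ (Ici 0) 0 = 0 →
    ∀ T > 0, ∃ K, LipschitzOnWith K (pairing v φ) (Icc 0 T)
  equation : ∀ φ, IsC1b φ → derivWithin φ (Ici 0) 0 = 0 →
    ∀ᵐ t ∂volume.restrict (Ioi (0 : ℝ)),
      Integrable (weakIntegrand β m Φ (v t) φ) (halfLine.prod halfLine) ∧
      HasDerivAt (pairing v φ)
        (1 / 2 * ∫ p, weakIntegrand β m Φ (v t) φ p ∂(halfLine.prod halfLine)) t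

end

end Compton

/-! Put `ν = v₀ dk` and `v(t) = e^{h(t)} v₀`. The equation becomes a pointwise ODE for the
logarithm, `∂ₜh(t,x) = ∫ S(x,y) e^{h(t,y)} dν(y)`, where `S` is antisymmetric, nonnegative for `x ≤
y`, and at most `A x^{-3/2} e^{ηy}` for `0 < x ≤ y`. Antisymmetry conserves mass. The sign of `S`
drives photons towards the origin, so the moment of the increasing weight `e^{ηx}` cannot grow
(`IsFlow.moment_le`). Hence `∂ₜh ≤ A X x^{-3/2}` with `X = ∫ e^{ηy} dν`, which is the pointwise
bound of the theorem. Since `ν` integrates every `e^{r x^{-3/2}}`, this bound dominates all later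
limits.

For a bounded kernel the ODE is solved by Picard–Lindelöf (`exists_isFlow`). The true kernel is
unbounded, so it is truncated to the squares `[1/(n+1), n+1]²`, and the truncated flows are shown to
be Cauchy in the squared Hellinger distance. Let `q` be the geometric mean of two densities and `H`
the squared difference of their square roots, so that the densities add up to `H + 2q`. For a common
kernel the derivative of `∫ H` is, by antisymmetry, `∬ S(x,y) H(x) q(y)`, and only an upper bound of
`S` is needed: the derivative is at most `A X ∫ x^{-3/2} H` (`dissipation_le`). The weight is
unbounded, but cutting it at height `N` costs only `O(e^{-sN})`, with `s` at choice
(`integral_weighted_le`). Grönwall's factor is `e^{BNt}` with `B = A X`; taking `s = Bt + 1` leaves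
`e^{-N}` (`IsFlow.hellinger_le`).

The bounds on `S` come from the cutoff (`R_le`). On its support `θy ≤ x` when `x ≤ y`, so `e^{-βx}
e^{β(x+y)/2} ≤ e^{β(1-θ)y/2}`, whence the threshold for `η`; and `(y-x)/(xy(x+y))` is at most a
constant times `x^{-3/2}`. The same comparability of energies bounds each row of `S`, so that `L¹`
convergence of the densities gives convergence of the growth rate at every point. -/

namespace Compton

/-! ### Bounded Borel functions as a Banach space -/

/-- The submodule of Borel measurable functions in the space of bounded functions on `ℝ`. -/
noncomputable def boundedMeasurable : Submodule ℝ (lp (fun _ : ℝ => ℝ) ⊤) where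
  carrier := {f | Measurable (f : ℝ → ℝ)}
  add_mem' {f g} hf hg := by
    have : Measurable (fun x => f x + g x) := hf.add hg
    exact this
  zero_mem' := by
    have : Measurable (fun _ : ℝ => (0 : ℝ)) := measurable_const
    exact this
  smul_mem' c f hf := by
    have : Measurable (fun x => c * f x) := hf.const_mul c
    exact this

/-- Uniform limits are pointwise limits, which preserve Borel measurability. Genuine functions,
rather than classes modulo null sets, make the ODE hold at every energy. -/
theorem isClosed_boundedMeasurable :
    IsClosed (boundedMeasurable : Set (lp (fun _ : ℝ => ℝ) ⊤)) := by
  refine isClosed_of_closure_subset fun f hf => ?_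
  obtain ⟨u, hu, hlim⟩ := mem_closure_iff_seq_limit.1 hf
  refine measurable_of_tendsto_metrizable (f := fun n => (u n : ℝ → ℝ)) hu ?_
  rw [tendsto_pi_nhds]
  intro x
  exact ((lp.evalCLM ℝ (fun _ : ℝ => ℝ) ⊤ x).continuous.tendsto f).comp hlim

instance : CompleteSpace boundedMeasurable := isClosed_boundedMeasurable.completeSpace_coe

/-- A bounded measurable function as an element of `boundedMeasurable`. -/
noncomputable def toBoundedMeasurable (f : ℝ → ℝ) (hf : Measurable f) (c : ℝ)
    (hc : ∀ x, |f x| ≤ c) : boundedMeasurable :=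
  ⟨⟨f, memℓp_infty ⟨c, by rintro _ ⟨x, rfl⟩; exact hc x⟩⟩, hf⟩

/-- Evaluation at a point, on `boundedMeasurable`. -/
noncomputable def evalBM (x : ℝ) : boundedMeasurable →L[ℝ] ℝ :=
  (lp.evalCLM ℝ (fun _ : ℝ => ℝ) ⊤ x).comp boundedMeasurable.subtypeL

theorem measurable_evalBM (f : boundedMeasurable) : Measurable (fun x => evalBM x f) := f.2

theorem abs_evalBM_le (f : boundedMeasurable) (x : ℝ) : |evalBM x f| ≤ ‖f‖ :=
  lp.norm_apply_le_norm ENNReal.top_ne_zero f.1 x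

theorem norm_boundedMeasurable_le {f : boundedMeasurable} {c : ℝ} (hc : 0 ≤ c)
    (h : ∀ x, |evalBM x f| ≤ c) : ‖f‖ ≤ c :=
  lp.norm_le_of_forall_le hc h

/-! ### The normalized equation for a bounded kernel -/

section rate

variable (S : ℝ → ℝ → ℝ) (ν : Measure ℝ)

/-- The growth rate at energy `x` of the density `e^h` with respect to `ν`. -/
noncomputable def rate (h : ℝ → ℝ) (x : ℝ) : ℝ := ∫ y, S x y * Real.exp (h y) ∂ν

variable {S ν}

theorem measurable_rate [SFinite ν] (hS : Measurable (Function.uncurry S)) {h : ℝ → ℝ}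
    (hh : Measurable h) : Measurable (rate S ν h) := by
  have : StronglyMeasurable (fun p : ℝ × ℝ => S p.1 p.2 * Real.exp (h p.2)) :=
    (hS.mul ((hh.comp measurable_snd).exp)).stronglyMeasurable
  exact this.integral_prod_right'.measurable

theorem integrable_exp_of_bdd [IsFiniteMeasure ν] {h : ℝ → ℝ} (hh : Measurable h) {c : ℝ}
    (hc : ∀ x, |h x| ≤ c) : Integrable (fun x => Real.exp (h x)) ν :=
  Integrable.of_bound hh.exp.aestronglyMeasurable (Real.exp c) (ae_of_all _ fun x => by
    rw [Real.norm_eq_abs, Real.abs_exp]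
    exact Real.exp_le_exp.2 ((le_abs_self _).trans (hc x)))

theorem integrable_mul_exp [SFinite ν] (hS : Measurable (Function.uncurry S)) {Λ : ℝ}
    (hΛ : ∀ x y, |S x y| ≤ Λ) {h : ℝ → ℝ} (hi : Integrable (fun x => Real.exp (h x)) ν) (x : ℝ) :
    Integrable (fun y => S x y * Real.exp (h y)) ν :=
  hi.bdd_mul (c := Λ) (hS.comp (measurable_const.prodMk measurable_id)).aestronglyMeasurable
    (ae_of_all _ fun y => hΛ x y)

theorem abs_rate_le [SFinite ν] (hS : Measurable (Function.uncurry S)) {Λ : ℝ}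
    (hΛ : ∀ x y, |S x y| ≤ Λ) {h : ℝ → ℝ} (hi : Integrable (fun x => Real.exp (h x)) ν) (x : ℝ) :
    |rate S ν h x| ≤ Λ * ∫ y, Real.exp (h y) ∂ν := by
  rw [rate, ← integral_const_mul]
  refine (abs_integral_le_integral_abs).trans (integral_mono (integrable_mul_exp hS hΛ hi x).abs
    (hi.const_mul _) fun y => ?_)
  simp only [abs_mul, Real.abs_exp]
  exact mul_le_mul_of_nonneg_right (hΛ x y) (Real.exp_pos _).le

theorem abs_exp_sub_exp_le {a b c : ℝ} (ha : a ≤ c) (hb : b ≤ c) :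
    |Real.exp a - Real.exp b| ≤ Real.exp c * |a - b| := by
  have key : ∀ a b : ℝ, a ≤ c → b ≤ a → Real.exp a - Real.exp b ≤ Real.exp c * (a - b) := by
    intro a b ha hb
    have h1 := Real.add_one_le_exp (b - a)
    have h2 : Real.exp b = Real.exp a * Real.exp (b - a) := by rw [← Real.exp_add]; ring_nf
    have h3 := Real.exp_le_exp.2 ha
    have h4 := Real.exp_pos a
    nlinarith
  rcases le_total b a with h | h
  · rw [abs_of_nonneg (sub_nonneg.2 (Real.exp_le_exp.2 h)), abs_of_nonneg (sub_nonneg.2 h)]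
    exact key a b ha h
  · rw [abs_sub_comm, abs_sub_comm a, abs_of_nonneg (sub_nonneg.2 (Real.exp_le_exp.2 h)),
      abs_of_nonneg (sub_nonneg.2 h)]
    exact key b a hb h

/-- The growth rate normalized so that it is bounded independently of `h`. -/
noncomputable def normalizedRate (S : ℝ → ℝ → ℝ) (ν : Measure ℝ) (h : ℝ → ℝ) (x : ℝ) : ℝ :=
  ν.real univ * (rate S ν h x / ∫ y, Real.exp (h y) ∂ν)

theorem abs_normalizedRate_le [IsFiniteMeasure ν] (hS : Measurable (Function.uncurry S)) {Λ : ℝ}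
    (hΛ : ∀ x y, |S x y| ≤ Λ) {h : ℝ → ℝ} (hh : Measurable h) {c : ℝ}
    (hc : ∀ x, |h x| ≤ c) (x : ℝ) : |normalizedRate S ν h x| ≤ ν.real univ * Λ := by
  have hΛ0 : 0 ≤ Λ := (abs_nonneg _).trans (hΛ 0 0)
  have hi := integrable_exp_of_bdd (ν := ν) hh hc
  have h0 : 0 ≤ ∫ y, Real.exp (h y) ∂ν := integral_nonneg fun y => (Real.exp_pos _).le
  rw [normalizedRate, abs_mul, abs_of_nonneg measureReal_nonneg, abs_div, abs_of_nonneg h0]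
  gcongr
  exact div_le_of_le_mul₀ h0 hΛ0 (abs_rate_le hS hΛ hi x)

theorem exp_neg_mul_le_integral_exp [IsFiniteMeasure ν] {h : ℝ → ℝ} (hh : Measurable h) {c : ℝ}
    (hc : ∀ x, |h x| ≤ c) : Real.exp (-c) * ν.real univ ≤ ∫ y, Real.exp (h y) ∂ν := by
  have : ∫ _, Real.exp (-c) ∂ν ≤ ∫ y, Real.exp (h y) ∂ν :=
    integral_mono (integrable_const _) (integrable_exp_of_bdd hh hc) fun y =>
      Real.exp_le_exp.2 (abs_le.1 (hc y)).1
  rw [integral_const, smul_eq_mul] at this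
  linarith

/-- On the ball of radius `c` the numerator and denominator of the quotient are Lipschitz in the
logarithm, and the denominator is at least `e^{-c} ν(ℝ)`. This is the Lipschitz constant for
Picard–Lindelöf. -/
theorem abs_normalizedRate_sub_le [IsFiniteMeasure ν] (hS : Measurable (Function.uncurry S))
    {Λ : ℝ} (hΛ : ∀ x y, |S x y| ≤ Λ) {g h : ℝ → ℝ} (hg : Measurable g) (hh : Measurable h)
    {c : ℝ} (hgc : ∀ x, |g x| ≤ c) (hhc : ∀ x, |h x| ≤ c) {δ : ℝ} (hδ : ∀ x, |g x - h x| ≤ δ)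
    (x : ℝ) : |normalizedRate S ν g x - normalizedRate S ν h x| ≤
      2 * Λ * Real.exp c * Real.exp c * ν.real univ * δ := by
  have hΛ0 : 0 ≤ Λ := (abs_nonneg _).trans (hΛ 0 0)
  have hδ0 : 0 ≤ δ := (abs_nonneg _).trans (hδ 0)
  have hig := integrable_exp_of_bdd (ν := ν) hg hgc
  have hih := integrable_exp_of_bdd (ν := ν) hh hhc
  set M := ν.real univ with hM
  have hM0 : 0 ≤ M := measureReal_nonneg
  rcases hM0.eq_or_lt with hM00 | hMpos
  · simp only [normalizedRate, ← hM, ← hM00, zero_mul, sub_zero, abs_zero, mul_zero, le_refl]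
  have e1 : ∀ y, |Real.exp (g y) - Real.exp (h y)| ≤ Real.exp c * δ := fun y =>
    (abs_exp_sub_exp_le ((le_abs_self _).trans (hgc y)) ((le_abs_self _).trans (hhc y))).trans
      (mul_le_mul_of_nonneg_left (hδ y) (Real.exp_pos _).le)
  set N₁ := ∫ y, Real.exp (g y) ∂ν
  set N₂ := ∫ y, Real.exp (h y) ∂ν
  set P₁ := rate S ν g x with hP₁
  set P₂ := rate S ν h x with hP₂
  have hN₁ : Real.exp (-c) * M ≤ N₁ := exp_neg_mul_le_integral_exp hg hgc
  have hN₂ : Real.exp (-c) * M ≤ N₂ := exp_neg_mul_le_integral_exp hh hhc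
  have hpos : 0 < Real.exp (-c) * M := by positivity
  have hN : |N₁ - N₂| ≤ Real.exp c * δ * M := by
    rw [← integral_sub hig hih]
    rw [← Real.norm_eq_abs]
    exact norm_integral_le_of_norm_le_const (ae_of_all _ e1)
  have hP : |P₁ - P₂| ≤ Λ * (Real.exp c * δ) * M := by
    rw [hP₁, hP₂, rate, rate, ← integral_sub (integrable_mul_exp hS hΛ hig x)
      (integrable_mul_exp hS hΛ hih x), ← Real.norm_eq_abs]
    refine norm_integral_le_of_norm_le_const (ae_of_all _ fun y => ?_)
    rw [← mul_sub, Real.norm_eq_abs, abs_mul]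
    exact mul_le_mul (hΛ x y) (e1 y) (abs_nonneg _) hΛ0
  have hQ : |P₂| ≤ Λ * N₂ := abs_rate_le hS hΛ hih x
  have hN₁p : 0 < N₁ := hpos.trans_le hN₁
  have hN₂p : 0 < N₂ := hpos.trans_le hN₂
  -- The difference of quotients is arranged so that one divides only by `N₁`, apart from the ratio
  -- `P₂ / N₂`, which is bounded by `Λ`.
  have hid : M * (P₁ / N₁) - M * (P₂ / N₂) =
      M * ((P₁ - P₂) / N₁ - P₂ / N₂ * ((N₁ - N₂) / N₁)) := by
    field_simp
    ring
  have b1 : |(P₁ - P₂) / N₁| ≤ Λ * Real.exp c * δ * Real.exp c := by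
    rw [abs_div, abs_of_pos hN₁p, div_le_iff₀ hN₁p]
    refine hP.trans ?_
    calc Λ * (Real.exp c * δ) * M = Λ * Real.exp c * δ * Real.exp c * (Real.exp (-c) * M) := by
          rw [show Λ * Real.exp c * δ * Real.exp c * (Real.exp (-c) * M) =
            Λ * (Real.exp c * δ) * M * (Real.exp c * Real.exp (-c)) by ring, ← Real.exp_add]
          simp
      _ ≤ _ := by gcongr
  have b2 : |(N₁ - N₂) / N₁| ≤ Real.exp c * δ * Real.exp c := by
    rw [abs_div, abs_of_pos hN₁p, div_le_iff₀ hN₁p]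
    refine hN.trans ?_
    calc Real.exp c * δ * M = Real.exp c * δ * Real.exp c * (Real.exp (-c) * M) := by
          rw [show Real.exp c * δ * Real.exp c * (Real.exp (-c) * M) =
            Real.exp c * δ * M * (Real.exp c * Real.exp (-c)) by ring, ← Real.exp_add]
          simp
      _ ≤ _ := by gcongr
  have b3 : |P₂ / N₂| ≤ Λ := by
    rw [abs_div, abs_of_pos hN₂p, div_le_iff₀ hN₂p]
    exact hQ
  simp only [normalizedRate]
  rw [← hM, hid, abs_mul, abs_of_nonneg hM0]
  have b4 : |(P₁ - P₂) / N₁ - P₂ / N₂ * ((N₁ - N₂) / N₁)| ≤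
      Λ * Real.exp c * δ * Real.exp c + Λ * (Real.exp c * δ * Real.exp c) := by
    refine (abs_sub _ _).trans (add_le_add b1 ?_)
    rw [abs_mul]
    exact mul_le_mul b3 b2 (abs_nonneg _) hΛ0
  refine (mul_le_mul_of_nonneg_left b4 hM0).trans (le_of_eq ?_)
  ring

/-- The normalized field is bounded by `ν(ℝ) Λ` on the whole space, so a solution starting at `0`
stays in the ball of radius `ν(ℝ) Λ T` up to time `T`. One application of Picard–Lindelöf thus
covers an arbitrarily long interval, without continuation. Negative times are included to have
two-sided derivatives at `0`. -/
theorem exists_normalized_flow [IsFiniteMeasure ν] (hS : Measurable (Function.uncurry S))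
    {Λ : ℝ} (hΛ : ∀ x y, |S x y| ≤ Λ) {T : ℝ} (hT : 0 < T) :
    ∃ h : ℝ → ℝ → ℝ, (∀ t, Measurable (h t)) ∧ (∀ x, h 0 x = 0) ∧
      (∃ c, ∀ t ∈ Ioo (-T) T, ∀ x, |h t x| ≤ c) ∧
      ∀ t ∈ Ioo (-T) T, ∀ x,
        HasDerivAt (fun s => h s x) (normalizedRate S ν (h t) x) t := by
  have hΛ0 : 0 ≤ Λ := (abs_nonneg _).trans (hΛ 0 0)
  let G : boundedMeasurable → boundedMeasurable := fun f =>
    toBoundedMeasurable (normalizedRate S ν fun x => evalBM x f)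
      (((measurable_rate hS (measurable_evalBM f)).div_const _).const_mul _) (ν.real univ * Λ)
      (abs_normalizedRate_le hS hΛ (measurable_evalBM f) (abs_evalBM_le f))
  have hG : ∀ f x, evalBM x (G f) = normalizedRate S ν (fun x => evalBM x f) x := fun f x => rfl
  have hLn : 0 ≤ ν.real univ * Λ := by positivity
  have ha : 0 ≤ ν.real univ * Λ * T := by positivity
  have hK : 0 ≤ 2 * Λ * Real.exp (ν.real univ * Λ * T) * Real.exp (ν.real univ * Λ * T) *
      ν.real univ := by positivity
  have h0mem : (0 : ℝ) ∈ Icc (-T) T := ⟨by linarith, hT.le⟩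
  have hPL : IsPicardLindelof (fun _ => G) (tmin := -T) (tmax := T) ⟨0, h0mem⟩ 0
      ⟨_, ha⟩ 0 ⟨_, hLn⟩ ⟨_, hK⟩ := by
    refine ⟨fun t _ => ?_, fun x _ => continuousOn_const, fun t _ f _ => ?_, ?_⟩
    · refine LipschitzOnWith.of_dist_le_mul fun f hf g hg => ?_
      rw [mem_closedBall_zero_iff] at hf hg
      rw [dist_eq_norm, dist_eq_norm]
      refine norm_boundedMeasurable_le (by positivity) fun x => ?_
      rw [map_sub, hG, hG]
      exact abs_normalizedRate_sub_le hS hΛ (measurable_evalBM f) (measurable_evalBM g)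
        (fun x => (abs_evalBM_le f x).trans hf) (fun x => (abs_evalBM_le g x).trans hg)
        (fun x => by rw [← map_sub]; exact abs_evalBM_le (f - g) x) x
    · exact norm_boundedMeasurable_le hLn fun x => by
        rw [hG]
        exact abs_normalizedRate_le hS hΛ (measurable_evalBM f) (abs_evalBM_le f) x
    · simp only [sub_zero, zero_sub, neg_neg, max_self, NNReal.coe_zero]
      exact le_rfl
  obtain ⟨α, hα0, hα⟩ := hPL.exists_eq_forall_mem_Icc_hasDerivWithinAt₀
  have hcont : ContinuousOn α (Icc (-T) T) := fun t ht => (hα t ht).continuousWithinAt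
  obtain ⟨c, hc⟩ := isCompact_Icc.exists_bound_of_continuousOn hcont
  refine ⟨fun t x => evalBM x (α t), fun t => measurable_evalBM _, fun x => ?_, ⟨c, ?_⟩, ?_⟩
  · have : α 0 = 0 := hα0
    simp [this]
  · intro t ht x
    exact (abs_evalBM_le _ x).trans (hc t (Ioo_subset_Icc_self ht))
  · intro t ht x
    have h1 := (hα t (Ioo_subset_Icc_self ht)).hasDerivAt (Icc_mem_nhds ht.1 ht.2)
    exact (evalBM x).hasFDerivAt.comp_hasDerivAt t h1

end rate

/-! ### Symmetrization, and flows of bounded antisymmetric kernels -/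

/-- A doubly integrable function is bounded in mean by another one as soon as its symmetrization
is. -/
theorem integral_prod_le_of_symm {ν : Measure ℝ} [SFinite ν] {F G : ℝ × ℝ → ℝ}
    (hF : Integrable F (ν.prod ν)) (hG : Integrable G (ν.prod ν))
    (h : ∀ᵐ p ∂ν.prod ν, F p + F p.swap ≤ G p + G p.swap) :
    ∫ p, F p ∂ν.prod ν ≤ ∫ p, G p ∂ν.prod ν := by
  have h1 := integral_mono_ae (hF.add hF.swap) (hG.add hG.swap) h
  have e : ∀ {K : ℝ × ℝ → ℝ}, Integrable K (ν.prod ν) →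
      ∫ p, (K + K ∘ Prod.swap) p ∂ν.prod ν = 2 * ∫ p, K p ∂ν.prod ν := by
    intro K hK
    have hswap : ∫ p, (K ∘ Prod.swap) p ∂ν.prod ν = ∫ p, K p ∂ν.prod ν := integral_prod_swap K
    rw [integral_add' hK hK.swap, hswap]
    ring
  rw [e hF, e hG] at h1
  linarith

theorem integral_prod_eq_of_symm {ν : Measure ℝ} [SFinite ν] {F G : ℝ × ℝ → ℝ}
    (hF : Integrable F (ν.prod ν)) (hG : Integrable G (ν.prod ν))
    (h : ∀ᵐ p ∂ν.prod ν, F p + F p.swap = G p + G p.swap) :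
    ∫ p, F p ∂ν.prod ν = ∫ p, G p ∂ν.prod ν :=
  le_antisymm (integral_prod_le_of_symm hF hG (h.mono fun _ hp => hp.le))
    (integral_prod_le_of_symm hG hF (h.mono fun _ hp => hp.ge))

/-- Differentiation of weighted masses of a family of densities `e^{g t}`. -/
theorem hasDerivAt_integral_mul_exp {ν : Measure ℝ} {φ : ℝ → ℝ} (hφ : Integrable φ ν)
    {g g' : ℝ → ℝ → ℝ} (hg : ∀ t, Measurable (g t)) (hg' : ∀ t, Measurable (g' t)) {c c' : ℝ}
    {U : Set ℝ} (hU : IsOpen U) (hc : ∀ t ∈ U, ∀ x, |g t x| ≤ c)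
    (hc' : ∀ t ∈ U, ∀ x, |g' t x| ≤ c')
    (hd : ∀ t ∈ U, ∀ x, HasDerivAt (fun s => g s x) (g' t x) t) {t : ℝ} (ht : t ∈ U) :
    HasDerivAt (fun s => ∫ x, φ x * Real.exp (g s x) ∂ν)
      (∫ x, φ x * (Real.exp (g t x) * g' t x) ∂ν) t := by
  have hb : ∀ t ∈ U, ∀ x, |Real.exp (g t x)| ≤ Real.exp c := fun t ht x => by
    rw [Real.abs_exp]
    exact Real.exp_le_exp.2 ((le_abs_self _).trans (hc t ht x))
  refine (hasDerivAt_integral_of_dominated_loc_of_deriv_le (hU.mem_nhds ht)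
    (F := fun s x => φ x * Real.exp (g s x)) (F' := fun s x => φ x * (Real.exp (g s x) * g' s x))
    (bound := fun x => |φ x| * (Real.exp c * c')) ?_ ?_ ?_ ?_ ?_ ?_).2
  · exact Filter.Eventually.of_forall fun s => hφ.1.mul (hg s).exp.aestronglyMeasurable
  · exact hφ.mul_bdd (hg t).exp.aestronglyMeasurable (ae_of_all _ (hb t ht))
  · exact hφ.1.mul ((hg t).exp.mul (hg' t)).aestronglyMeasurable
  · refine ae_of_all _ fun x s hs => ?_
    rw [Real.norm_eq_abs, abs_mul, abs_mul]
    have := hb s hs x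
    have := hc' s hs x
    gcongr
  · exact hφ.abs.mul_const _
  · exact ae_of_all _ fun x s hs => ((hd s hs x).exp).const_mul (φ x)

/-- `h` is the logarithm of the density, with respect to `ν`, of a solution on `(-T, T)` of the
evolution equation with kernel `S` and initial datum `ν`. -/
structure IsFlow (S : ℝ → ℝ → ℝ) (ν : Measure ℝ) (T : ℝ) (h : ℝ → ℝ → ℝ) : Prop where
  measurable : ∀ t, Measurable (h t)
  zero : ∀ x, h 0 x = 0
  bdd : ∃ c, ∀ t ∈ Ioo (-T) T, ∀ x, |h t x| ≤ c
  hasDerivAt : ∀ t ∈ Ioo (-T) T, ∀ x, HasDerivAt (fun s => h s x) (rate S ν (h t) x) t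
  mass : ∀ t ∈ Ioo (-T) T, ∫ x, Real.exp (h t x) ∂ν = ν.real univ

theorem integrable_prod_of_bdd_kernel {S : ℝ → ℝ → ℝ} {ν : Measure ℝ} [SFinite ν]
    (hS : Measurable (Function.uncurry S)) {Λ : ℝ} (hΛ : ∀ x y, |S x y| ≤ Λ) {f g : ℝ → ℝ}
    (hf : Integrable f ν) (hg : Integrable g ν) :
    Integrable (fun p : ℝ × ℝ => S p.1 p.2 * (f p.1 * g p.2)) (ν.prod ν) :=
  (hf.mul_prod hg).bdd_mul hS.aestronglyMeasurable (ae_of_all _ fun p => hΛ p.1 p.2)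

theorem integral_mul_rate {S : ℝ → ℝ → ℝ} {ν : Measure ℝ} [SFinite ν]
    (hS : Measurable (Function.uncurry S)) {Λ : ℝ} (hΛ : ∀ x y, |S x y| ≤ Λ) {f h : ℝ → ℝ}
    (hf : Integrable f ν) (hh : Integrable (fun x => Real.exp (h x)) ν) :
    ∫ x, f x * rate S ν h x ∂ν = ∫ p, S p.1 p.2 * (f p.1 * Real.exp (h p.2)) ∂(ν.prod ν) := by
  rw [integral_prod _ (integrable_prod_of_bdd_kernel hS hΛ hf hh)]
  refine integral_congr_ae (ae_of_all _ fun x => ?_)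
  simp only [rate]
  rw [← integral_const_mul]
  refine integral_congr_ae (ae_of_all _ fun y => ?_)
  ring

/-- Exchanging the two variables changes the sign of the double integral. This is conservation of
mass. -/
theorem integral_exp_mul_rate {S : ℝ → ℝ → ℝ} {ν : Measure ℝ} [SFinite ν]
    (hS : Measurable (Function.uncurry S)) (ha : ∀ x y, S y x = -S x y) {Λ : ℝ}
    (hΛ : ∀ x y, |S x y| ≤ Λ) {h : ℝ → ℝ} (hh : Integrable (fun x => Real.exp (h x)) ν) :
    ∫ x, Real.exp (h x) * rate S ν h x ∂ν = 0 := by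
  rw [integral_mul_rate hS hΛ hh hh, ← integral_zero (ℝ × ℝ) ℝ (μ := ν.prod ν)]
  refine integral_prod_eq_of_symm (integrable_prod_of_bdd_kernel hS hΛ hh hh)
    (integrable_zero _ _ _) (ae_of_all _ fun p => ?_)
  simp only [Prod.fst_swap, Prod.snd_swap, ha p.1 p.2]
  ring

/-- Along the normalized flow the derivative of the mass is a multiple of the integral that vanishes
by antisymmetry. The mass therefore keeps its initial value `ν(ℝ)`, the normalizing factor is `1`,
and the normalized flow solves the original equation. -/
theorem exists_isFlow {S : ℝ → ℝ → ℝ} {ν : Measure ℝ} [IsFiniteMeasure ν]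
    (hS : Measurable (Function.uncurry S)) (ha : ∀ x y, S y x = -S x y) {Λ : ℝ}
    (hΛ : ∀ x y, |S x y| ≤ Λ) {T : ℝ} (hT : 0 < T) : ∃ h, IsFlow S ν T h := by
  obtain ⟨h, hm, h0, ⟨c, hc⟩, hd⟩ := exists_normalized_flow (ν := ν) hS hΛ hT
  have h0T : (0 : ℝ) ∈ Ioo (-T) T := ⟨by linarith, hT⟩
  have hi : ∀ t ∈ Ioo (-T) T, Integrable (fun x => Real.exp (h t x)) ν := fun t ht =>
    integrable_exp_of_bdd (hm t) (hc t ht)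
  have hmass : ∀ t ∈ Ioo (-T) T, ∫ x, Real.exp (h t x) ∂ν = ν.real univ := by
    have hder : ∀ t ∈ Ioo (-T) T, HasDerivAt (fun s => ∫ x, Real.exp (h s x) ∂ν) 0 t := by
      intro t ht
      have := hasDerivAt_integral_mul_exp (ν := ν) (φ := fun _ => 1) (integrable_const _)
        (g' := fun t => normalizedRate S ν (h t)) hm
        (fun t => ((measurable_rate hS (hm t)).div_const _).const_mul _) isOpen_Ioo hc
        (fun t ht => abs_normalizedRate_le hS hΛ (hm t) (hc t ht)) hd ht
      simp only [one_mul] at this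
      convert this using 1
      rw [← mul_zero (ν.real univ / ∫ y, Real.exp (h t y) ∂ν),
        ← integral_exp_mul_rate hS ha hΛ (hi t ht), ← integral_const_mul]
      refine integral_congr_ae (ae_of_all _ fun x => ?_)
      simp only [normalizedRate]
      ring
    intro t ht
    have hconst := (convex_Ioo (-T) T).is_const_of_fderivWithin_eq_zero (𝕜 := ℝ)
      (f := fun s => ∫ x, Real.exp (h s x) ∂ν)
      (fun s hs => (hder s hs).differentiableAt.differentiableWithinAt) (fun s hs => by
        rw [fderivWithin_of_isOpen isOpen_Ioo hs]
        ext
        simp [(hder s hs).deriv]) ht h0T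
    simpa [h0] using hconst
  refine ⟨h, hm, h0, ⟨c, hc⟩, fun t ht x => ?_, hmass⟩
  convert hd t ht x using 1
  rw [normalizedRate, hmass t ht]
  -- For `ν = 0` the normalizing quotient is `0 / 0`; both sides then vanish.
  rcases (measureReal_nonneg (μ := ν) (s := univ)).eq_or_lt with h0 | hpos
  · rw [← h0, zero_mul]
    have : ν = 0 := by
      rw [eq_comm, measureReal_eq_zero_iff] at h0
      exact Measure.measure_univ_eq_zero.1 h0
    simp [rate, this]
  · field_simp

/-! ### Weights, and the classes of kernels and of initial measures -/

/-- The singular weight `k ^ (-3/2)`. -/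
noncomputable def singularWeight (x : ℝ) : ℝ := (|x| ^ (3 / 2 : ℝ))⁻¹

theorem singularWeight_nonneg (x : ℝ) : 0 ≤ singularWeight x := by
  unfold singularWeight
  positivity

theorem measurable_singularWeight : Measurable singularWeight := by
  unfold singularWeight
  fun_prop

theorem singularWeight_le {x y : ℝ} (hy : 0 < y) (h : y ≤ x) :
    singularWeight x ≤ singularWeight y := by
  unfold singularWeight
  rw [abs_of_pos hy, abs_of_pos (hy.trans_le h)]
  gcongr

theorem singularWeight_le_one {x : ℝ} (h : 1 ≤ x) : singularWeight x ≤ 1 :=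
  (singularWeight_le one_pos h).trans (by simp [singularWeight])

/-- The weight `exp (r k ^ (-3/2) + η k)`. -/
noncomputable def weight (η r x : ℝ) : ℝ := Real.exp (r * singularWeight x) * Real.exp (η * x)

theorem weight_pos (η r x : ℝ) : 0 < weight η r x := by
  unfold weight
  positivity

theorem measurable_weight (η r : ℝ) : Measurable (weight η r) :=
  (measurable_singularWeight.const_mul r).exp.mul (measurable_id.const_mul η).exp

theorem weight_add (η r s x : ℝ) :
    weight η (r + s) x = weight η r x * Real.exp (s * singularWeight x) := by
  simp only [weight, add_mul, Real.exp_add]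
  ring

theorem exp_le_weight {η x : ℝ} (hη : 0 ≤ η) (hx : 0 < x) (r : ℝ) :
    Real.exp (r * singularWeight x) ≤ weight η r x :=
  le_mul_of_one_le_right (Real.exp_pos _).le (Real.one_le_exp (by positivity))

/-- The structural properties of the kernel which are used for the evolution. -/
structure IsKernel (A η : ℝ) (S : ℝ → ℝ → ℝ) : Prop where
  A_nonneg : 0 ≤ A
  η_nonneg : 0 ≤ η
  measurable : Measurable (Function.uncurry S)
  antisymm : ∀ x y, S y x = -S x y
  nonneg : ∀ x y, x ≤ y → 0 ≤ S x y
  le : ∀ x y, 0 < x → x ≤ y → S x y ≤ A * singularWeight x * Real.exp (η * y)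
  support : ∀ x y, S x y ≠ 0 → 0 < x ∧ 0 < y
  bddRow : ∀ x, ∃ c, ∀ y, |S x y| ≤ c

/-- The integrability assumptions on the initial measure. -/
structure IsDatum (η : ℝ) (ν : Measure ℝ) : Prop where
  pos : ∀ᵐ x ∂ν, 0 < x
  integrable_exp_singular : ∀ r, Integrable (fun x => Real.exp (r * singularWeight x)) ν
  integrable_exp : Integrable (fun x => Real.exp (η * x)) ν

/-- Only one factor of the weight is large at a time: the singular exponential is bounded on `[1,
∞)` and `e^{ηx}` on `(0, 1]`. -/
theorem IsDatum.integrable_weight {η : ℝ} {ν : Measure ℝ} (hν : IsDatum η ν) (hη : 0 ≤ η)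
    (r : ℝ) : Integrable (weight η r) ν := by
  refine ((hν.integrable_exp.const_mul (Real.exp |r|)).add
    ((hν.integrable_exp_singular |r|).const_mul (Real.exp η))).mono'
    (measurable_weight η r).aestronglyMeasurable ?_
  filter_upwards [hν.pos] with x hx
  rw [Real.norm_eq_abs, abs_of_pos (weight_pos _ _ _)]
  have hw := singularWeight_nonneg x
  have hr : r * singularWeight x ≤ |r| * singularWeight x :=
    mul_le_mul_of_nonneg_right (le_abs_self r) hw
  simp only [Pi.add_apply, weight]
  rcases le_total 1 x with h | h
  · have : r * singularWeight x ≤ |r| :=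
      hr.trans (mul_le_of_le_one_right (abs_nonneg r) (singularWeight_le_one h))
    exact (mul_le_mul_of_nonneg_right (Real.exp_le_exp.2 this) (Real.exp_pos _).le).trans
      (le_add_of_nonneg_right (by positivity))
  · have : η * x ≤ η := mul_le_of_le_one_right hη h
    refine le_trans ?_ (le_add_of_nonneg_left (by positivity))
    rw [mul_comm]
    gcongr

namespace IsKernel

variable {A η : ℝ} {S : ℝ → ℝ → ℝ}

/-- Above the diagonal this is an axiom; below it the kernel is nonpositive. The bound is one-sided:
the singularity sits on the first variable alone, which is what the a priori and stability estimates
exploit. -/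
theorem le_mul_exp (hS : IsKernel A η S) (x y : ℝ) :
    S x y ≤ A * singularWeight x * Real.exp (η * y) := by
  have h0 : 0 ≤ A * singularWeight x * Real.exp (η * y) :=
    mul_nonneg (mul_nonneg hS.A_nonneg (singularWeight_nonneg x)) (Real.exp_pos _).le
  by_cases h : S x y = 0
  · rwa [h]
  rcases le_total x y with hxy | hxy
  · exact hS.le x y (hS.support x y h).1 hxy
  · have h1 := hS.nonneg y x hxy
    have h2 := hS.antisymm x y
    linarith

/-- Both `S x y` and `-S x y = S y x` obey the one-sided bound. The loss to a product of weights is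
harmless, because it serves only as a domination. -/
theorem abs_le (hS : IsKernel A η S) (x y : ℝ) :
    |S x y| ≤ A * (weight η 1 x * weight η 1 y) := by
  have hA := hS.A_nonneg
  have hη := hS.η_nonneg
  by_cases h : S x y = 0
  · rw [h, abs_zero]
    have := weight_pos η 1 x
    have := weight_pos η 1 y
    positivity
  obtain ⟨hx, hy⟩ := hS.support x y h
  have key : ∀ x y, 0 < x → 0 < y →
      A * singularWeight x * Real.exp (η * y) ≤ A * (weight η 1 x * weight η 1 y) := by
    intro x y hx hy
    rw [mul_assoc]
    have h1 : singularWeight x ≤ weight η 1 x := by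
      have := exp_le_weight hη hx 1
      have := Real.add_one_le_exp (singularWeight x)
      rw [one_mul] at *
      linarith
    have h2 : Real.exp (η * y) ≤ weight η 1 y :=
      le_mul_of_one_le_left (Real.exp_pos _).le
        (Real.one_le_exp (by rw [one_mul]; exact singularWeight_nonneg y))
    have := weight_pos η 1 x
    gcongr
  rw [abs_le']
  refine ⟨(hS.le_mul_exp x y).trans (key x y hx hy), ?_⟩
  rw [← hS.antisymm, mul_comm (weight η 1 x)]
  exact (hS.le_mul_exp y x).trans (key y x hy hx)

theorem integrable_row {ν : Measure ℝ} (hS : IsKernel A η S) {f : ℝ → ℝ}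
    (hf : Integrable f ν) (x : ℝ) : Integrable (fun y => S x y * f y) ν := by
  obtain ⟨c, hc⟩ := hS.bddRow x
  exact hf.bdd_mul (hS.measurable.comp (measurable_const.prodMk measurable_id)).aestronglyMeasurable
    (ae_of_all _ hc)

theorem rate_le {ν : Measure ℝ} (hS : IsKernel A η S) {h : ℝ → ℝ}
    (hh : Integrable (fun y => Real.exp (h y)) ν)
    (hη : Integrable (fun y => Real.exp (η * y) * Real.exp (h y)) ν) (x : ℝ) :
    rate S ν h x ≤ A * singularWeight x * ∫ y, Real.exp (η * y) * Real.exp (h y) ∂ν := by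
  rw [rate, ← integral_const_mul]
  refine integral_mono (hS.integrable_row hh x) (hη.const_mul _) fun y => ?_
  simp only [← mul_assoc]
  exact mul_le_mul_of_nonneg_right (hS.le_mul_exp x y) (Real.exp_pos _).le

end IsKernel

/-! ### A priori bounds uniform in the truncation -/

namespace IsFlow

variable {A η : ℝ} {S : ℝ → ℝ → ℝ} {ν : Measure ℝ} {T : ℝ} {h : ℝ → ℝ → ℝ}

theorem integrable_exp [IsFiniteMeasure ν] (hh : IsFlow S ν T h) {t : ℝ} (ht : t ∈ Ioo (-T) T) :
    Integrable (fun x => Real.exp (h t x)) ν := by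
  obtain ⟨c, hc⟩ := hh.bdd
  exact integrable_exp_of_bdd (hh.measurable t) (hc t ht)

theorem integrable_mul_exp (hh : IsFlow S ν T h) {φ : ℝ → ℝ} (hφ : Integrable φ ν) {t : ℝ}
    (ht : t ∈ Ioo (-T) T) : Integrable (fun x => φ x * Real.exp (h t x)) ν := by
  obtain ⟨c, hc⟩ := hh.bdd
  refine hφ.mul_bdd (c := Real.exp c) (hh.measurable t).exp.aestronglyMeasurable
    (ae_of_all _ fun x => ?_)
  rw [Real.norm_eq_abs, Real.abs_exp]
  exact Real.exp_le_exp.2 ((le_abs_self _).trans (hc t ht x))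

theorem abs_rate_le [IsFiniteMeasure ν] (hh : IsFlow S ν T h) (hS : Measurable (Function.uncurry S)) {Λ : ℝ}
    (hΛ : ∀ x y, |S x y| ≤ Λ) {t : ℝ} (ht : t ∈ Ioo (-T) T) (x : ℝ) :
    |rate S ν (h t) x| ≤ Λ * ν.real univ := by
  rw [← hh.mass t ht]
  exact Compton.abs_rate_le hS hΛ (hh.integrable_exp ht) x

/-- The derivative of the moment, once symmetrized, has integrand `S(x,y) (e^{ηx} - e^{ηy})
e^{h(x)+h(y)}`, which is nonpositive because the kernel is nonnegative exactly in the direction that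
lowers the energy. -/
theorem moment_le [IsFiniteMeasure ν] (hh : IsFlow S ν T h) (hS : IsKernel A η S) {Λ : ℝ} (hΛ : ∀ x y, |S x y| ≤ Λ)
    (hν : IsDatum η ν) {t : ℝ} (ht : t ∈ Ico 0 T) :
    ∫ x, Real.exp (η * x) * Real.exp (h t x) ∂ν ≤ ∫ x, Real.exp (η * x) ∂ν := by
  have hη := hS.η_nonneg
  obtain ⟨c, hc⟩ := hh.bdd
  have hsub : Icc 0 t ⊆ Ioo (-T) T := fun s hs =>
    ⟨by linarith [hs.1, ht.1, ht.2], hs.2.trans_lt ht.2⟩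
  have hd : ∀ s ∈ Ioo (-T) T, HasDerivAt (fun s => ∫ x, Real.exp (η * x) * Real.exp (h s x) ∂ν)
      (∫ x, Real.exp (η * x) * (Real.exp (h s x) * rate S ν (h s) x) ∂ν) s := fun s hs =>
    hasDerivAt_integral_mul_exp hν.integrable_exp hh.measurable
      (fun s => measurable_rate hS.measurable (hh.measurable s)) isOpen_Ioo hc
      (fun s hs => hh.abs_rate_le hS.measurable hΛ hs) hh.hasDerivAt hs
  have hneg : ∀ s ∈ Ioo (-T) T,
      ∫ x, Real.exp (η * x) * (Real.exp (h s x) * rate S ν (h s) x) ∂ν ≤ 0 := by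
    intro s hs
    have hi := hh.integrable_mul_exp hν.integrable_exp hs
    simp_rw [← mul_assoc]
    rw [integral_mul_rate hS.measurable hΛ hi (hh.integrable_exp hs),
      ← integral_zero (ℝ × ℝ) ℝ (μ := ν.prod ν)]
    refine integral_prod_le_of_symm
      (integrable_prod_of_bdd_kernel hS.measurable hΛ hi (hh.integrable_exp hs))
      (integrable_zero _ _ _) (ae_of_all _ fun p => ?_)
    obtain ⟨x, y⟩ := p
    simp only [Prod.swap_prod_mk, hS.antisymm x y, add_zero]
    have key : S x y * (Real.exp (η * x) - Real.exp (η * y)) ≤ 0 := by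
      rcases le_total x y with hxy | hxy
      · refine mul_nonpos_of_nonneg_of_nonpos (hS.nonneg x y hxy) (sub_nonpos.2 ?_)
        gcongr
      · refine mul_nonpos_of_nonpos_of_nonneg ?_ (sub_nonneg.2 ?_)
        · have := hS.nonneg y x hxy
          have := hS.antisymm x y
          linarith
        · gcongr
    have := mul_nonpos_of_nonpos_of_nonneg key
      (mul_pos (Real.exp_pos (h s x)) (Real.exp_pos (h s y))).le
    linarith
  have hanti : AntitoneOn (fun s => ∫ x, Real.exp (η * x) * Real.exp (h s x) ∂ν) (Icc 0 t) := by
    refine antitoneOn_of_deriv_nonpos (convex_Icc 0 t)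
      (fun s hs => (hd s (hsub hs)).continuousAt.continuousWithinAt) (fun s hs => ?_)
      fun s hs => ?_
    · exact (hd s (hsub (interior_subset hs))).differentiableAt.differentiableWithinAt
    · rw [(hd s (hsub (interior_subset hs))).deriv]
      exact hneg s (hsub (interior_subset hs))
  simpa [hh.zero] using hanti (left_mem_Icc.2 ht.1) (right_mem_Icc.2 ht.1) ht.1

/-- The one-sided rate bound and the decreasing moment are integrated in time. The constant does not
involve `Λ`, so it survives the removal of the truncation. -/
theorem le_mul_singularWeight [IsFiniteMeasure ν] (hh : IsFlow S ν T h) (hS : IsKernel A η S) {Λ : ℝ}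
    (hΛ : ∀ x y, |S x y| ≤ Λ) (hν : IsDatum η ν) {t : ℝ} (ht : t ∈ Ico 0 T) (x : ℝ) :
    h t x ≤ t * (A * ∫ y, Real.exp (η * y) ∂ν) * singularWeight x := by
  have hsub : Icc 0 t ⊆ Ioo (-T) T := fun s hs =>
    ⟨by linarith [hs.1, ht.1, ht.2], hs.2.trans_lt ht.2⟩
  have := (convex_Icc 0 t).image_sub_le_mul_sub_of_deriv_le (f := fun s => h s x)
    (C := A * singularWeight x * ∫ y, Real.exp (η * y) ∂ν)
    (fun s hs => (hh.hasDerivAt s (hsub hs) x).continuousAt.continuousWithinAt)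
    (fun s hs => (hh.hasDerivAt s (hsub (interior_subset hs)) x).differentiableAt
      |>.differentiableWithinAt)
    (fun s hs => by
      have hs' := interior_subset hs
      rw [(hh.hasDerivAt s (hsub hs') x).deriv]
      refine (hS.rate_le (hh.integrable_exp (hsub hs'))
        (hh.integrable_mul_exp hν.integrable_exp (hsub hs')) x).trans ?_
      exact mul_le_mul_of_nonneg_left
        (hh.moment_le hS hΛ hν ⟨hs'.1, hs'.2.trans_lt ht.2⟩)
        (mul_nonneg hS.A_nonneg (singularWeight_nonneg x)))
    0 (left_mem_Icc.2 ht.1) t (right_mem_Icc.2 ht.1) ht.1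
  simp only [hh.zero, sub_zero] at this
  linarith

end IsFlow

/-! ### Stability in the Hellinger distance -/

/-- Grönwall: `e^{-Ks} y(s) - cs` is nonincreasing, since its derivative is at most `c (e^{-Ks} -
1)`. -/
theorem le_mul_exp_of_deriv_le {y y' : ℝ → ℝ} {t K c : ℝ} (ht : 0 ≤ t) (hK : 0 ≤ K) (hc : 0 ≤ c)
    (hy : ∀ s ∈ Icc 0 t, HasDerivAt y (y' s) s) (h0 : y 0 = 0)
    (h : ∀ s ∈ Icc 0 t, y' s ≤ K * y s + c) : y t ≤ t * c * Real.exp (K * t) := by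
  have hd : ∀ s ∈ Icc 0 t, HasDerivAt (fun s => Real.exp (-K * s) * y s - c * s)
      (Real.exp (-K * s) * (-K) * y s + Real.exp (-K * s) * y' s - c) s := by
    intro s hs
    have h1 : HasDerivAt (fun s => Real.exp (-K * s)) (Real.exp (-K * s) * (-K)) s := by
      simpa using ((hasDerivAt_id s).const_mul (-K)).exp
    have h2 : HasDerivAt (fun s => c * s) c s := by simpa using (hasDerivAt_id s).const_mul c
    exact (h1.mul (hy s hs)).sub h2
  have hanti : AntitoneOn (fun s => Real.exp (-K * s) * y s - c * s) (Icc 0 t) := by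
    refine antitoneOn_of_deriv_nonpos (convex_Icc 0 t)
      (fun s hs => (hd s hs).continuousAt.continuousWithinAt)
      (fun s hs => (hd s (interior_subset hs)).differentiableAt.differentiableWithinAt)
      fun s hs => ?_
    have hs' := interior_subset hs
    rw [(hd s hs').deriv]
    have h1 : Real.exp (-K * s) ≤ 1 := Real.exp_le_one_iff.2 (by nlinarith [hs'.1])
    have h2 := Real.exp_pos (-K * s)
    have h3 := h s hs'
    nlinarith [mul_le_mul_of_nonneg_left h3 h2.le]
  have h1 := hanti (left_mem_Icc.2 ht) (right_mem_Icc.2 ht) ht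
  simp only [h0, mul_zero, sub_zero] at h1
  have h2 : y t = Real.exp (K * t) * (Real.exp (-K * t) * y t) := by
    rw [← mul_assoc, ← Real.exp_add]
    simp
  rw [h2, mul_comm]
  exact mul_le_mul_of_nonneg_right (by linarith) (Real.exp_pos _).le

theorem sq_exp_half_sub (a b : ℝ) : (Real.exp (a / 2) - Real.exp (b / 2)) ^ 2 =
    Real.exp a + Real.exp b - 2 * Real.exp ((a + b) / 2) := by
  have h1 : Real.exp a = Real.exp (a / 2) * Real.exp (a / 2) := by rw [← Real.exp_add]; ring_nf
  have h2 : Real.exp b = Real.exp (b / 2) * Real.exp (b / 2) := by rw [← Real.exp_add]; ring_nf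
  have h3 : Real.exp ((a + b) / 2) = Real.exp (a / 2) * Real.exp (b / 2) := by
    rw [← Real.exp_add]; ring_nf
  rw [h1, h2, h3]
  ring

theorem exp_mean_le (a b : ℝ) :
    Real.exp ((a + b) / 2) ≤ (Real.exp a + Real.exp b) / 2 := by
  have := sq_exp_half_sub a b
  nlinarith [sq_nonneg (Real.exp (a / 2) - Real.exp (b / 2))]

/-- The squared Hellinger distance of the measures `e^f ν` and `e^g ν`. -/
noncomputable def hellinger (ν : Measure ℝ) (f g : ℝ → ℝ) : ℝ :=
  ∫ x, (Real.exp (f x / 2) - Real.exp (g x / 2)) ^ 2 ∂ν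

section

variable {A η : ℝ} {S : ℝ → ℝ → ℝ} {ν : Measure ℝ} {f g : ℝ → ℝ}

theorem integrable_exp_mean (hf : Measurable f) (hg : Measurable g) {φ : ℝ → ℝ}
    (hφ : AEStronglyMeasurable φ ν)
    (hif : Integrable (fun x => φ x * Real.exp (f x)) ν)
    (hig : Integrable (fun x => φ x * Real.exp (g x)) ν) :
    Integrable (fun x => φ x * Real.exp ((f x + g x) / 2)) ν := by
  refine ((hif.abs.add hig.abs).div_const 2).mono'
    (hφ.mul ((hf.add hg).div_const 2).exp.aestronglyMeasurable) (ae_of_all _ fun x => ?_)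
  simp only [Real.norm_eq_abs, abs_mul, Real.abs_exp, Pi.add_apply]
  have := mul_le_mul_of_nonneg_left (exp_mean_le (f x) (g x)) (abs_nonneg (φ x))
  linarith

theorem integrable_mul_sq (hf : Measurable f) (hg : Measurable g) {φ : ℝ → ℝ}
    (hφ : AEStronglyMeasurable φ ν)
    (hif : Integrable (fun x => φ x * Real.exp (f x)) ν)
    (hig : Integrable (fun x => φ x * Real.exp (g x)) ν) :
    Integrable (fun x => φ x * (Real.exp (f x / 2) - Real.exp (g x / 2)) ^ 2) ν := by
  refine ((hif.add hig).sub ((integrable_exp_mean hf hg hφ hif hig).const_mul 2)).congr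
    (ae_of_all _ fun x => ?_)
  simp only [sq_exp_half_sub, Pi.add_apply, Pi.sub_apply]
  ring

/-- Up to a term which is controlled near the origin, the evolution contracts the Hellinger
distance. -/
theorem dissipation_le [SFinite ν] (hS : IsKernel A η S) {Λ : ℝ} (hΛ : ∀ x y, |S x y| ≤ Λ)
    (hf : Measurable f) (hg : Measurable g)
    (hif : Integrable (fun x => Real.exp (f x)) ν) (hig : Integrable (fun x => Real.exp (g x)) ν)
    (hwf : Integrable (fun x => singularWeight x * Real.exp (f x)) ν)
    (hwg : Integrable (fun x => singularWeight x * Real.exp (g x)) ν)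
    (hef : Integrable (fun x => Real.exp (η * x) * Real.exp (f x)) ν)
    (heg : Integrable (fun x => Real.exp (η * x) * Real.exp (g x)) ν) {X : ℝ}
    (hXf : ∫ x, Real.exp (η * x) * Real.exp (f x) ∂ν ≤ X)
    (hXg : ∫ x, Real.exp (η * x) * Real.exp (g x) ∂ν ≤ X) :
    -∫ p, S p.1 p.2 * (Real.exp ((f p.1 + g p.1) / 2) * (Real.exp (f p.2) + Real.exp (g p.2)))
      ∂(ν.prod ν) ≤
      A * X * ∫ x, singularWeight x * (Real.exp (f x / 2) - Real.exp (g x / 2)) ^ 2 ∂ν := by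
  have hq : Integrable (fun x => Real.exp ((f x + g x) / 2)) ν := by
    have := integrable_exp_mean hf hg (φ := fun _ => 1) (ν := ν) aestronglyMeasurable_const
      (by simpa using hif) (by simpa using hig)
    simpa using this
  have heq := integrable_exp_mean hf hg (ν := ν) (φ := fun x => Real.exp (η * x))
    (measurable_id.const_mul η).exp.aestronglyMeasurable hef heg
  have hwH := integrable_mul_sq hf hg measurable_singularWeight.aestronglyMeasurable hwf hwg
  have hF := integrable_prod_of_bdd_kernel hS.measurable hΛ hq (hif.add hig)
  have hG := (hwH.mul_prod heq).const_mul A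
  have hle := integral_prod_le_of_symm hF.neg hG (ae_of_all _ fun p => by
    obtain ⟨x, y⟩ := p
    simp only [Prod.swap_prod_mk, Pi.neg_apply, Pi.add_apply, hS.antisymm x y]
    have hx := sq_exp_half_sub (f x) (g x)
    have hy := sq_exp_half_sub (f y) (g y)
    have hxn := sq_nonneg (Real.exp (f x / 2) - Real.exp (g x / 2))
    have hyn := sq_nonneg (Real.exp (f y / 2) - Real.exp (g y / 2))
    set Hx := (Real.exp (f x / 2) - Real.exp (g x / 2)) ^ 2
    set Hy := (Real.exp (f y / 2) - Real.exp (g y / 2)) ^ 2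
    have hqx := Real.exp_pos ((f x + g x) / 2)
    have hqy := Real.exp_pos ((f y + g y) / 2)
    set qx := Real.exp ((f x + g x) / 2)
    set qy := Real.exp ((f y + g y) / 2)
    -- After substituting `e^f + e^g = H + 2q`, the products `qx * qy` cancel by antisymmetry. What
    -- remains is `S(x,y) Hx qy + S(y,x) Hy qx`, and each term has a nonnegative factor next to the
    -- kernel, so the one-sided bound applies to both.
    have ex : Real.exp (f x) + Real.exp (g x) = Hx + 2 * qx := by linarith
    have ey : Real.exp (f y) + Real.exp (g y) = Hy + 2 * qy := by linarith
    rw [ex, ey]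
    have hA := hS.A_nonneg
    have h1 := mul_le_mul_of_nonneg_right (hS.le_mul_exp x y) (mul_nonneg hqy.le hxn)
    have h2 := mul_le_mul_of_nonneg_right (hS.le_mul_exp y x) (mul_nonneg hqx.le hyn)
    rw [hS.antisymm x y] at h2
    linarith)
  rw [integral_neg', integral_const_mul,
    integral_prod_mul (fun x => singularWeight x * (Real.exp (f x / 2) - Real.exp (g x / 2)) ^ 2)
      (fun y => Real.exp (η * y) * Real.exp ((f y + g y) / 2))] at hle
  refine hle.trans ?_
  -- The geometric mean of the densities is below their arithmetic mean, so it inherits the moment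
  -- bound.
  have hX : ∫ x, Real.exp (η * x) * Real.exp ((f x + g x) / 2) ∂ν ≤ X := by
    have : ∫ x, Real.exp (η * x) * Real.exp ((f x + g x) / 2) ∂ν ≤
        ∫ x, (Real.exp (η * x) * Real.exp (f x) + Real.exp (η * x) * Real.exp (g x)) / 2 ∂ν :=
      integral_mono heq ((hef.add heg).div_const 2) fun x => by
        have := mul_le_mul_of_nonneg_left (exp_mean_le (f x) (g x)) (Real.exp_pos (η * x)).le
        simp only
        linarith
    rw [integral_div, integral_add hef heg] at this
    linarith
  have h0 : 0 ≤ ∫ x, singularWeight x * (Real.exp (f x / 2) - Real.exp (g x / 2)) ^ 2 ∂ν :=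
    integral_nonneg fun x => mul_nonneg (singularWeight_nonneg x) (sq_nonneg _)
  rw [mul_assoc, mul_comm X]
  have hA := hS.A_nonneg
  gcongr

/-- Where the weight `w` is at most `N` it is replaced by `N`. Elsewhere the squared difference is
at most `2 e^{rw}`, `w ≤ e^w`, and the factor `e^{s(w-N)} ≥ 1` is inserted. The parameter `s` stays
free so that the tail can beat Grönwall's exponential. -/
theorem integral_weighted_le {r s N : ℝ} (hf : Measurable f) (hg : Measurable g)
    (hif : Integrable (fun x => Real.exp (f x)) ν) (hig : Integrable (fun x => Real.exp (g x)) ν)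
    (hwf : Integrable (fun x => singularWeight x * Real.exp (f x)) ν)
    (hwg : Integrable (fun x => singularWeight x * Real.exp (g x)) ν)
    (hfr : ∀ x, f x ≤ r * singularWeight x) (hgr : ∀ x, g x ≤ r * singularWeight x)
    (hs : 0 ≤ s) (hN : 0 ≤ N)
    (hi : Integrable (fun x => Real.exp ((r + 1 + s) * singularWeight x)) ν) :
    ∫ x, singularWeight x * (Real.exp (f x / 2) - Real.exp (g x / 2)) ^ 2 ∂ν ≤
      N * hellinger ν f g +
        2 * Real.exp (-(s * N)) * ∫ x, Real.exp ((r + 1 + s) * singularWeight x) ∂ν := by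
  have hH : Integrable (fun x => (Real.exp (f x / 2) - Real.exp (g x / 2)) ^ 2) ν := by
    have := integrable_mul_sq hf hg (φ := fun _ => 1) (ν := ν) aestronglyMeasurable_const
      (by simpa using hif) (by simpa using hig)
    simpa using this
  have hwH := integrable_mul_sq hf hg measurable_singularWeight.aestronglyMeasurable hwf hwg
  rw [hellinger, ← integral_const_mul, ← integral_const_mul,
    ← integral_add (hH.const_mul N) (hi.const_mul _)]
  refine integral_mono hwH ((hH.const_mul N).add (hi.const_mul _)) fun x => ?_
  simp only
  have hw := singularWeight_nonneg x
  have hH0 := sq_nonneg (Real.exp (f x / 2) - Real.exp (g x / 2))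
  have hH2 : (Real.exp (f x / 2) - Real.exp (g x / 2)) ^ 2 ≤
      2 * Real.exp (r * singularWeight x) := by
    rw [sq_exp_half_sub]
    have := Real.exp_le_exp.2 (hfr x)
    have := Real.exp_le_exp.2 (hgr x)
    have := Real.exp_pos ((f x + g x) / 2)
    linarith
  set H := (Real.exp (f x / 2) - Real.exp (g x / 2)) ^ 2
  set w := singularWeight x
  rcases le_total w N with h | h
  · have := mul_le_mul_of_nonneg_right h hH0
    have : 0 ≤ 2 * Real.exp (-(s * N)) * Real.exp ((r + 1 + s) * w) := by positivity
    linarith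
  · have hw1 : w ≤ Real.exp w := by linarith [Real.add_one_le_exp w]
    have hN1 : 1 ≤ Real.exp (-(s * N)) * Real.exp (s * w) := by
      rw [← Real.exp_add]
      exact Real.one_le_exp (by nlinarith)
    have e : Real.exp ((r + 1 + s) * w) = Real.exp (r * w) * Real.exp w * Real.exp (s * w) := by
      rw [← Real.exp_add, ← Real.exp_add]
      ring_nf
    rw [e]
    calc w * H ≤ Real.exp w * (2 * Real.exp (r * w)) * 1 := by
          rw [mul_one]
          gcongr
      _ ≤ Real.exp w * (2 * Real.exp (r * w)) * (Real.exp (-(s * N)) * Real.exp (s * w)) := by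
          gcongr
      _ = 2 * Real.exp (-(s * N)) * (Real.exp (r * w) * Real.exp w * Real.exp (s * w)) := by
          ring
      _ ≤ _ := le_add_of_nonneg_left (by positivity)

end

section stability

variable {A η : ℝ} {ν : Measure ℝ} [IsFiniteMeasure ν]

theorem perturbation_le {S₁ S₂ : ℝ → ℝ → ℝ} (hS₁ : Measurable (Function.uncurry S₁))
    (hS₂ : Measurable (Function.uncurry S₂)) {Λ₁ Λ₂ : ℝ} (hΛ₁ : ∀ x y, |S₁ x y| ≤ Λ₁)
    (hΛ₂ : ∀ x y, |S₂ x y| ≤ Λ₂) {p q D : ℝ → ℝ} (hp : Integrable p ν) (hq : Integrable q ν)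
    (hD : Integrable D ν) (hpD : ∀ᵐ x ∂ν, |p x| ≤ D x) (hqD : ∀ᵐ x ∂ν, |q x| ≤ D x) :
    ∫ z, S₁ z.1 z.2 * (p z.1 * q z.2) ∂(ν.prod ν) - ∫ z, S₂ z.1 z.2 * (p z.1 * q z.2) ∂(ν.prod ν) ≤
      ∫ z, |S₁ z.1 z.2 - S₂ z.1 z.2| * (D z.1 * D z.2) ∂(ν.prod ν) := by
  rw [← integral_sub (integrable_prod_of_bdd_kernel hS₁ hΛ₁ hp hq)
    (integrable_prod_of_bdd_kernel hS₂ hΛ₂ hp hq)]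
  refine integral_mono_ae ((integrable_prod_of_bdd_kernel hS₁ hΛ₁ hp hq).sub
    (integrable_prod_of_bdd_kernel hS₂ hΛ₂ hp hq))
    (integrable_prod_of_bdd_kernel (S := fun x y => |S₁ x y - S₂ x y|) (Λ := Λ₁ + Λ₂)
      (by
        have := hS₁.sub hS₂
        exact this.abs)
      (fun x y => by
        rw [abs_abs]
        exact (abs_sub _ _).trans (add_le_add (hΛ₁ x y) (hΛ₂ x y))) hD hD) ?_
  have h1 : ∀ᵐ z ∂ν.prod ν, |p z.1| ≤ D z.1 := Measure.quasiMeasurePreserving_fst.ae hpD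
  have h2 : ∀ᵐ z ∂ν.prod ν, |q z.2| ≤ D z.2 := Measure.quasiMeasurePreserving_snd.ae hqD
  filter_upwards [h1, h2] with z hz1 hz2
  rw [← sub_mul]
  refine (le_abs_self _).trans ?_
  rw [abs_mul, abs_mul]
  have := (abs_nonneg _).trans hz1
  gcongr

/-- Stability of the flow with respect to the kernel, in the Hellinger distance. -/
theorem IsFlow.hellinger_le {S₁ S₂ : ℝ → ℝ → ℝ} (hS₁ : IsKernel A η S₁) (hS₂ : IsKernel A η S₂)
    {Λ₁ Λ₂ : ℝ} (hΛ₁ : ∀ x y, |S₁ x y| ≤ Λ₁) (hΛ₂ : ∀ x y, |S₂ x y| ≤ Λ₂) (hν : IsDatum η ν)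
    {T : ℝ} {h₁ h₂ : ℝ → ℝ → ℝ} (hh₁ : IsFlow S₁ ν T h₁) (hh₂ : IsFlow S₂ ν T h₂) {B : ℝ}
    (hB : B = A * ∫ x, Real.exp (η * x) ∂ν) {t : ℝ} (ht : t ∈ Ico 0 T) {N : ℝ} (hN : 0 ≤ N) :
    hellinger ν (h₁ t) (h₂ t) ≤ t *
      (B * (2 * Real.exp (-((B * t + 1) * N)) *
        ∫ x, Real.exp ((t * B + 1 + (B * t + 1)) * singularWeight x) ∂ν) +
      ∫ z, |S₁ z.1 z.2 - S₂ z.1 z.2| * (Real.exp (t * B * singularWeight z.1) *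
        Real.exp (t * B * singularWeight z.2))
        ∂(ν.prod ν)) * Real.exp (B * N * t) := by
  have hX0 : 0 ≤ ∫ x, Real.exp (η * x) ∂ν := integral_nonneg fun x => (Real.exp_pos _).le
  have hB0 : 0 ≤ B := hB ▸ mul_nonneg hS₁.A_nonneg hX0
  obtain ⟨c₁, hc₁⟩ := hh₁.bdd
  obtain ⟨c₂, hc₂⟩ := hh₂.bdd
  have hsub : Icc 0 t ⊆ Ioo (-T) T := fun s hs =>
    ⟨by linarith [hs.1, ht.1, ht.2], hs.2.trans_lt ht.2⟩
  have hsub' : ∀ s ∈ Icc 0 t, s ∈ Ico 0 T := fun s hs => ⟨hs.1, hs.2.trans_lt ht.2⟩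
  have hw : Integrable singularWeight ν :=
    (hν.integrable_exp_singular 1).mono' measurable_singularWeight.aestronglyMeasurable
      (ae_of_all _ fun x => by
        rw [Real.norm_eq_abs, abs_of_nonneg (singularWeight_nonneg x), one_mul]
        linarith [Real.add_one_le_exp (singularWeight x)])
  have hq : ∀ s ∈ Ioo (-T) T, Integrable (fun x => Real.exp ((h₁ s x + h₂ s x) / 2)) ν := by
    intro s hs
    have := integrable_exp_mean (hh₁.measurable s) (hh₂.measurable s) (φ := fun _ => 1) (ν := ν)
      aestronglyMeasurable_const (by simpa using hh₁.integrable_exp hs)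
      (by simpa using hh₂.integrable_exp hs)
    simpa using this
  -- Both masses equal `ν(ℝ)`, so only the integral of the geometric mean depends on time. The
  -- factor `1` matches the form of `hasDerivAt_integral_mul_exp`.
  have hHell : ∀ s ∈ Ioo (-T) T, hellinger ν (h₁ s) (h₂ s) =
      2 * ν.real univ - 2 * ∫ x, 1 * Real.exp ((h₁ s x + h₂ s x) / 2) ∂ν := by
    intro s hs
    simp only [hellinger, sq_exp_half_sub, one_mul]
    have hadd : Integrable (fun x => Real.exp (h₁ s x) + Real.exp (h₂ s x)) ν :=
      (hh₁.integrable_exp hs).add (hh₂.integrable_exp hs)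
    rw [integral_sub hadd ((hq s hs).const_mul 2),
      integral_add (hh₁.integrable_exp hs) (hh₂.integrable_exp hs), integral_const_mul,
      hh₁.mass s hs, hh₂.mass s hs]
    ring
  set y' : ℝ → ℝ := fun s => -2 * ∫ x, 1 * (Real.exp ((h₁ s x + h₂ s x) / 2) *
    ((rate S₁ ν (h₁ s) x + rate S₂ ν (h₂ s) x) / 2)) ∂ν with hy'
  have hder : ∀ s ∈ Icc 0 t, HasDerivAt (fun s => hellinger ν (h₁ s) (h₂ s)) (y' s) s := by
    intro s hs
    have h1 := hasDerivAt_integral_mul_exp (ν := ν) (φ := fun _ => 1) (integrable_const _)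
      (g := fun s x => (h₁ s x + h₂ s x) / 2)
      (g' := fun s x => (rate S₁ ν (h₁ s) x + rate S₂ ν (h₂ s) x) / 2)
      (fun s => ((hh₁.measurable s).add (hh₂.measurable s)).div_const 2)
      (fun s => ((measurable_rate hS₁.measurable (hh₁.measurable s)).add
        (measurable_rate hS₂.measurable (hh₂.measurable s))).div_const 2) (U := Ioo (-T) T)
      (c := (c₁ + c₂) / 2) (c' := (Λ₁ * ν.real univ + Λ₂ * ν.real univ) / 2)
      isOpen_Ioo
      (fun s hs x => by
        rw [abs_div, abs_two]
        have := (abs_add_le (h₁ s x) (h₂ s x)).trans (add_le_add (hc₁ s hs x) (hc₂ s hs x))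
        gcongr)
      (fun s hs x => by
        rw [abs_div, abs_two]
        have := (abs_add_le (rate S₁ ν (h₁ s) x) (rate S₂ ν (h₂ s) x)).trans
          (add_le_add (hh₁.abs_rate_le hS₁.measurable hΛ₁ hs x)
            (hh₂.abs_rate_le hS₂.measurable hΛ₂ hs x))
        gcongr)
      (fun s hs x => ((hh₁.hasDerivAt s hs x).add (hh₂.hasDerivAt s hs x)).div_const 2) (hsub hs)
    have h2 := (h1.const_mul 2).const_sub (2 * ν.real univ)
    refine (h2.congr_deriv (by rw [hy']; ring)).congr_of_eventuallyEq ?_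
    filter_upwards [isOpen_Ioo.mem_nhds (hsub hs)] with u hu using hHell u hu
  have hE0 : 0 ≤ ∫ z, |S₁ z.1 z.2 - S₂ z.1 z.2| * (Real.exp (t * B * singularWeight z.1) *
        Real.exp (t * B * singularWeight z.2))
        ∂(ν.prod ν) := integral_nonneg fun z => by positivity
  have hJ0 : 0 ≤ ∫ x, Real.exp ((t * B + 1 + (B * t + 1)) * singularWeight x) ∂ν :=
    integral_nonneg fun x => (Real.exp_pos _).le
  refine le_mul_exp_of_deriv_le (y := fun s => hellinger ν (h₁ s) (h₂ s)) ht.1 (by positivity)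
    (by positivity) hder (by simp [hellinger, hh₁.zero, hh₂.zero]) fun s hs => ?_
  have hsT := hsub hs
  have hr₁ : ∀ x, h₁ s x ≤ t * B * singularWeight x := fun x => by
    refine (hh₁.le_mul_singularWeight hS₁ hΛ₁ hν (hsub' s hs) x).trans ?_
    rw [← hB]
    have := singularWeight_nonneg x
    have := hs.2
    gcongr
  have hr₂ : ∀ x, h₂ s x ≤ t * B * singularWeight x := fun x => by
    refine (hh₂.le_mul_singularWeight hS₂ hΛ₂ hν (hsub' s hs) x).trans ?_
    rw [← hB]
    have := singularWeight_nonneg x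
    have := hs.2
    gcongr
  have hi₁ := hh₁.integrable_exp hsT
  have hi₂ := hh₂.integrable_exp hsT
  have hw₁ := hh₁.integrable_mul_exp hw hsT
  have hw₂ := hh₂.integrable_mul_exp hw hsT
  have hdis := dissipation_le hS₁ hΛ₁ (hh₁.measurable s) (hh₂.measurable s) hi₁ hi₂ hw₁ hw₂
    (hh₁.integrable_mul_exp hν.integrable_exp hsT) (hh₂.integrable_mul_exp hν.integrable_exp hsT)
    (hh₁.moment_le hS₁ hΛ₁ hν (hsub' s hs)) (hh₂.moment_le hS₂ hΛ₂ hν (hsub' s hs))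
  -- The decay exponent `B * t + 1` exceeds Grönwall's `B * t` by one, which leaves a net `e^{-N}`.
  have hwt := integral_weighted_le (N := N) (r := t * B) (s := B * t + 1) (hh₁.measurable s)
    (hh₂.measurable s) hi₁ hi₂ hw₁ hw₂ hr₁ hr₂ (by have := ht.1; positivity) hN
    (hν.integrable_exp_singular _)
  have hpert := perturbation_le hS₁.measurable hS₂.measurable hΛ₁ hΛ₂ (hq s hsT) hi₂
    (hν.integrable_exp_singular (t * B))
    (ae_of_all _ fun x => by
      rw [Real.abs_exp]
      refine Real.exp_le_exp.2 ?_
      linarith [hr₁ x, hr₂ x])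
    (ae_of_all _ fun x => by
      rw [Real.abs_exp]
      exact Real.exp_le_exp.2 (hr₂ x))
  have hmul : ∀ {S : ℝ → ℝ → ℝ} {Λ : ℝ} {h : ℝ → ℝ}, Measurable (Function.uncurry S) →
      (∀ x y, |S x y| ≤ Λ) → Integrable (fun x => Real.exp (h x)) ν → Measurable h →
      Integrable (fun x => Real.exp ((h₁ s x + h₂ s x) / 2) * rate S ν h x) ν := by
    intro S Λ h hS hΛ hi hm
    exact (hq s hsT).mul_bdd (measurable_rate hS hm).aestronglyMeasurable
      (ae_of_all _ fun x => Compton.abs_rate_le hS hΛ hi x)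
  -- The second flow is treated as if it were driven by `S₁`: this gives the dissipation term for
  -- the single kernel `S₁`, and the correction tests `S₁ - S₂` against the geometric mean and
  -- `e^{h₂}`.
  have hy : y' s = -∫ p, S₁ p.1 p.2 * (Real.exp ((h₁ s p.1 + h₂ s p.1) / 2) *
      (Real.exp (h₁ s p.2) + Real.exp (h₂ s p.2))) ∂(ν.prod ν) +
      (∫ z, S₁ z.1 z.2 * (Real.exp ((h₁ s z.1 + h₂ s z.1) / 2) * Real.exp (h₂ s z.2)) ∂(ν.prod ν) -
        ∫ z, S₂ z.1 z.2 * (Real.exp ((h₁ s z.1 + h₂ s z.1) / 2) * Real.exp (h₂ s z.2))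
          ∂(ν.prod ν)) := by
    simp only [mul_add]
    rw [integral_add (integrable_prod_of_bdd_kernel hS₁.measurable hΛ₁ (hq s hsT) hi₁)
      (integrable_prod_of_bdd_kernel hS₁.measurable hΛ₁ (hq s hsT) hi₂),
      ← integral_mul_rate hS₁.measurable hΛ₁ (hq s hsT) hi₁,
      ← integral_mul_rate hS₂.measurable hΛ₂ (hq s hsT) hi₂, hy']
    have e : ∫ x, 1 * (Real.exp ((h₁ s x + h₂ s x) / 2) *
        ((rate S₁ ν (h₁ s) x + rate S₂ ν (h₂ s) x) / 2)) ∂ν =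
        (∫ x, Real.exp ((h₁ s x + h₂ s x) / 2) * rate S₁ ν (h₁ s) x ∂ν +
          ∫ x, Real.exp ((h₁ s x + h₂ s x) / 2) * rate S₂ ν (h₂ s) x ∂ν) / 2 := by
      rw [← integral_add (hmul hS₁.measurable hΛ₁ hi₁ (hh₁.measurable s))
        (hmul hS₂.measurable hΛ₂ hi₂ (hh₂.measurable s)), ← integral_div]
      refine integral_congr_ae (ae_of_all _ fun x => ?_)
      simp only
      ring
    simp only [e]
    ring
  rw [hy]
  rw [← hB] at hdis
  have := mul_le_mul_of_nonneg_left hwt hB0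
  linarith

end stability

/-! ### Truncated kernels and their convergence -/

section truncation

open Classical in
/-- The restriction of a kernel to the square `[1 / (n + 1), n + 1]²`. -/
noncomputable def truncation (S : ℝ → ℝ → ℝ) (n : ℕ) (x y : ℝ) : ℝ :=
  if x ∈ Icc (1 / (n + 1 : ℝ)) (n + 1) ∧ y ∈ Icc (1 / (n + 1 : ℝ)) (n + 1) then S x y else 0

theorem abs_truncation_le (S : ℝ → ℝ → ℝ) (n : ℕ) (x y : ℝ) : |truncation S n x y| ≤ |S x y| := by
  unfold truncation
  split_ifs <;> simp

theorem abs_sub_truncation_le (S : ℝ → ℝ → ℝ) (n : ℕ) (x y : ℝ) :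
    |S x y - truncation S n x y| ≤ |S x y| := by
  unfold truncation
  split_ifs <;> simp

/-- The squares increase with the index, so two truncations differ only outside the smaller square,
where `S` minus its truncation is `S` itself. -/
theorem abs_truncation_sub_truncation_le (S : ℝ → ℝ → ℝ) {n m : ℕ} (h : n ≤ m) (x y : ℝ) :
    |truncation S n x y - truncation S m x y| ≤ |S x y - truncation S n x y| := by
  have hc : (n : ℝ) ≤ m := by exact_mod_cast h
  have hsub : Icc (1 / (n + 1 : ℝ)) (n + 1) ⊆ Icc (1 / (m + 1 : ℝ)) (m + 1) :=
    Icc_subset_Icc (by gcongr) (by gcongr)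
  unfold truncation
  split_ifs with h1 h2 h2
  · simp
  · exact absurd ⟨hsub h1.1, hsub h1.2⟩ h2
  · simp [abs_neg]
  · simp

theorem eventually_truncation_eq {S : ℝ → ℝ → ℝ} (hS : ∀ x y, S x y ≠ 0 → 0 < x ∧ 0 < y)
    (x y : ℝ) : ∀ᶠ n in Filter.atTop, truncation S n x y = S x y := by
  by_cases h : S x y = 0
  · refine Filter.Eventually.of_forall fun n => ?_
    have := abs_truncation_le S n x y
    rw [h, abs_zero] at this
    rw [h]
    exact abs_nonpos_iff.1 this
  obtain ⟨hx, hy⟩ := hS x y h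
  have key : ∀ z : ℝ, 0 < z →
      ∀ᶠ n : ℕ in Filter.atTop, z ∈ Icc (1 / (n + 1 : ℝ)) (n + 1) := by
    intro z hz
    filter_upwards [(tendsto_one_div_add_atTop_nhds_zero_nat (𝕜 := ℝ)).eventually_lt_const hz,
      tendsto_natCast_atTop_atTop.eventually_ge_atTop z] with n h1 h2
    exact ⟨h1.le, by linarith⟩
  filter_upwards [key x hx, key y hy] with n h1 h2
  exact if_pos ⟨h1, h2⟩

variable {A η : ℝ} {S : ℝ → ℝ → ℝ}

theorem IsKernel.truncation (hS : IsKernel A η S) (n : ℕ) :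
    IsKernel A η (truncation S n) where
  A_nonneg := hS.A_nonneg
  η_nonneg := hS.η_nonneg
  measurable := by
    refine Measurable.ite ?_ hS.measurable measurable_const
    exact (measurable_fst measurableSet_Icc).inter (measurable_snd measurableSet_Icc)
  antisymm x y := by
    unfold Compton.truncation
    by_cases h : x ∈ Icc (1 / (n + 1 : ℝ)) (n + 1) ∧ y ∈ Icc (1 / (n + 1 : ℝ)) (n + 1)
    · rw [if_pos h, if_pos h.symm, hS.antisymm]
    · rw [if_neg h, if_neg fun h' => h h'.symm, neg_zero]
  nonneg x y h := by
    unfold Compton.truncation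
    split_ifs
    · exact hS.nonneg x y h
    · rfl
  le x y hx h := by
    unfold Compton.truncation
    split_ifs
    · exact hS.le x y hx h
    · exact mul_nonneg (mul_nonneg hS.A_nonneg (singularWeight_nonneg x)) (Real.exp_pos _).le
  support x y h := by
    refine hS.support x y fun h0 => h ?_
    have := abs_truncation_le S n x y
    rw [h0, abs_zero] at this
    exact abs_nonpos_iff.1 this
  bddRow x := by
    obtain ⟨c, hc⟩ := hS.bddRow x
    exact ⟨c, fun y => (abs_truncation_le S n x y).trans (hc y)⟩

theorem IsKernel.exists_abs_truncation_le (hS : IsKernel A η S) (n : ℕ) :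
    ∃ Λ, ∀ x y, |Compton.truncation S n x y| ≤ Λ := by
  have hA := hS.A_nonneg
  have hη := hS.η_nonneg
  set C := Real.exp (1 * singularWeight (1 / (n + 1 : ℝ))) * Real.exp (η * (n + 1)) with hC
  refine ⟨A * (C * C), fun x y => ?_⟩
  have hC0 : 0 ≤ C := by positivity
  unfold Compton.truncation
  split_ifs with h
  · have key : ∀ z ∈ Icc (1 / (n + 1 : ℝ)) (n + 1), weight η 1 z ≤ C := by
      intro z hz
      have := singularWeight_le (by positivity) hz.1
      have := hz.2
      unfold weight
      rw [hC]
      gcongr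
    refine (hS.abs_le x y).trans ?_
    have := key x h.1
    have := key y h.2
    have := (weight_pos η 1 x).le
    have := (weight_pos η 1 y).le
    gcongr
  · rw [abs_zero]
    positivity

variable {ν : Measure ℝ}

/-- With `a = e^{f/2}` and `b = e^{g/2}`, one has `|a² - b²| = |a - b| (a + b)`, and Young's
inequality with parameter `l` separates the factors. Hellinger convergence thus gives `L¹`
convergence when the masses are bounded. -/
theorem integral_abs_exp_sub_le {f g : ℝ → ℝ} (hf : Measurable f) (hg : Measurable g)
    (hif : Integrable (fun x => Real.exp (f x)) ν) (hig : Integrable (fun x => Real.exp (g x)) ν)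
    {l : ℝ} (hl : 0 < l) :
    ∫ x, |Real.exp (f x) - Real.exp (g x)| ∂ν ≤
      l / 2 * hellinger ν f g + (∫ x, Real.exp (f x) ∂ν + ∫ x, Real.exp (g x) ∂ν) / l := by
  have hH : Integrable (fun x => (Real.exp (f x / 2) - Real.exp (g x / 2)) ^ 2) ν := by
    have := integrable_mul_sq hf hg (φ := fun _ => 1) (ν := ν) aestronglyMeasurable_const
      (by simpa using hif) (by simpa using hig)
    simpa using this
  have hadd : Integrable (fun x => (Real.exp (f x) + Real.exp (g x)) / l) ν :=
    (hif.add hig).div_const l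
  rw [hellinger, ← integral_const_mul, ← integral_add hif hig, ← integral_div,
    ← integral_add (hH.const_mul _) hadd]
  refine integral_mono (hif.sub hig).abs ((hH.const_mul _).add hadd) fun x => ?_
  have ef : Real.exp (f x) = Real.exp (f x / 2) * Real.exp (f x / 2) := by
    rw [← Real.exp_add]; ring_nf
  have eg : Real.exp (g x) = Real.exp (g x / 2) * Real.exp (g x / 2) := by
    rw [← Real.exp_add]; ring_nf
  simp only
  rw [ef, eg]
  set a := Real.exp (f x / 2)
  set b := Real.exp (g x / 2)
  have ha : 0 < a := Real.exp_pos _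
  have hb : 0 < b := Real.exp_pos _
  have e1 : |a * a - b * b| = |a - b| * (a + b) := by
    rw [show a * a - b * b = (a - b) * (a + b) by ring, abs_mul, abs_of_pos (add_pos ha hb)]
  have e2 : (a - b) ^ 2 = |a - b| ^ 2 := (sq_abs _).symm
  rw [e1]
  have h1 : (l * |a - b| - (a + b)) ^ 2 ≥ 0 := sq_nonneg _
  have h2 : (a + b) ^ 2 ≤ 2 * (a * a + b * b) := by nlinarith [sq_nonneg (a - b)]
  have h3 : |a - b| * (a + b) * l ≤ (l / 2 * (a - b) ^ 2 + (a * a + b * b) / l) * l := by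
    rw [add_mul, div_mul_cancel₀ _ hl.ne', e2]
    nlinarith
  exact le_of_mul_le_mul_right h3 hl

theorem IsKernel.abs_mul_exp_le (hS : IsKernel A η S) (r x y : ℝ) :
    |S x y| * (Real.exp (r * singularWeight x) * Real.exp (r * singularWeight y)) ≤
      A * (weight η (1 + r) x * weight η (1 + r) y) := by
  rw [weight_add, weight_add]
  have := mul_le_mul_of_nonneg_right (hS.abs_le x y)
    (mul_pos (Real.exp_pos (r * singularWeight x)) (Real.exp_pos (r * singularWeight y))).le
  linarith

theorem IsKernel.integrable_abs_mul_exp [SFinite ν] (hS : IsKernel A η S) (hν : IsDatum η ν)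
    (r : ℝ) :
    Integrable (fun z : ℝ × ℝ => |S z.1 z.2| *
      (Real.exp (r * singularWeight z.1) * Real.exp (r * singularWeight z.2))) (ν.prod ν) := by
  have hi := hν.integrable_weight hS.η_nonneg (1 + r)
  have hm : Measurable fun x => Real.exp (r * singularWeight x) :=
    (measurable_singularWeight.const_mul r).exp
  refine ((hi.mul_prod hi).const_mul A).mono' ?_ (ae_of_all _ fun z => ?_)
  · exact (hS.measurable.abs.mul ((hm.comp measurable_fst).mul
      (hm.comp measurable_snd))).aestronglyMeasurable
  · rw [Real.norm_eq_abs, abs_of_nonneg (by positivity)]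
    exact hS.abs_mul_exp_le r z.1 z.2

/-- The kernels truncated away from the origin and from infinity converge, in mean. -/
theorem IsKernel.tendsto_integral_sub_truncation [SFinite ν] (hS : IsKernel A η S)
    (hν : IsDatum η ν) (r : ℝ) :
    Filter.Tendsto (fun n => ∫ z, |S z.1 z.2 - Compton.truncation S n z.1 z.2| *
      (Real.exp (r * singularWeight z.1) * Real.exp (r * singularWeight z.2)) ∂(ν.prod ν))
      Filter.atTop (nhds 0) := by
  have hm : Measurable fun x => Real.exp (r * singularWeight x) :=
    (measurable_singularWeight.const_mul r).exp
  rw [← integral_zero (ℝ × ℝ) ℝ (μ := ν.prod ν)]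
  refine tendsto_integral_of_dominated_convergence _ (fun n => ?_)
    (hS.integrable_abs_mul_exp hν r) (fun n => ae_of_all _ fun z => ?_) (ae_of_all _ fun z => ?_)
  · have := (hS.measurable.sub (hS.truncation n).measurable).abs
    exact (this.mul ((hm.comp measurable_fst).mul (hm.comp measurable_snd))).aestronglyMeasurable
  · rw [Real.norm_eq_abs, abs_of_nonneg (by positivity)]
    exact mul_le_mul_of_nonneg_right (abs_sub_truncation_le S n _ _) (by positivity)
  · refine tendsto_const_nhds.congr' ?_
    filter_upwards [eventually_truncation_eq hS.support z.1 z.2] with n hn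
    simp [hn]

/-- The kernels truncated away from the origin and from infinity converge, row by row. -/
theorem IsKernel.tendsto_integral_row_sub_truncation (hS : IsKernel A η S) {f : ℝ → ℝ}
    (hf : Integrable f ν) (x : ℝ) :
    Filter.Tendsto (fun n => ∫ y, |S x y - Compton.truncation S n x y| * f y ∂ν)
      Filter.atTop (nhds 0) := by
  rw [← integral_zero ℝ ℝ (μ := ν)]
  refine tendsto_integral_of_dominated_convergence _ (fun n => ?_)
    (hS.integrable_row hf x).abs (fun n => ae_of_all _ fun y => ?_) (ae_of_all _ fun y => ?_)
  · have := (hS.measurable.sub (hS.truncation n).measurable).abs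
    exact (this.comp (measurable_const.prodMk measurable_id)).aestronglyMeasurable.mul hf.1
  · rw [norm_mul, abs_mul, Real.norm_eq_abs, abs_abs, Real.norm_eq_abs]
    exact mul_le_mul_of_nonneg_right (abs_sub_truncation_le S n _ _) (by positivity)
  · refine tendsto_const_nhds.congr' ?_
    filter_upwards [eventually_truncation_eq hS.support x y] with n hn
    simp [hn]

theorem IsFlow.abs_rate_le_row [IsFiniteMeasure ν] {T : ℝ} {h : ℝ → ℝ → ℝ} (hh : IsFlow S ν T h)
    {K : ℝ → ℝ → ℝ} {x c : ℝ} (hc : ∀ y, |K x y| ≤ c) {t : ℝ} (ht : t ∈ Ioo (-T) T) :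
    |rate K ν (h t) x| ≤ c * ν.real univ := by
  rw [← hh.mass t ht, rate, ← integral_const_mul, ← Real.norm_eq_abs]
  refine norm_integral_le_of_norm_le ((hh.integrable_exp ht).const_mul c)
    (ae_of_all _ fun y => ?_)
  rw [Real.norm_eq_abs, abs_mul, Real.abs_exp]
  exact mul_le_mul_of_nonneg_right (hc y) (Real.exp_pos _).le

theorem continuousOn_rate {U : Set ℝ} {h : ℝ → ℝ → ℝ} (hm : ∀ t ∈ U, Measurable (h t))
    (hS : IsKernel A η S) (hcont : ∀ x, ContinuousOn (fun s => h s x) U) {b : ℝ → ℝ}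
    (hb : Integrable (fun x => Real.exp (b x)) ν) (hle : ∀ t ∈ U, ∀ x, h t x ≤ b x) (x : ℝ) :
    ContinuousOn (fun s => rate S ν (h s) x) U := by
  obtain ⟨c, hc⟩ := hS.bddRow x
  refine continuousOn_of_dominated (bound := fun y => c * Real.exp (b y)) (fun s hs => ?_)
    (fun s hs => ae_of_all _ fun y => ?_) (hb.const_mul c) (ae_of_all _ fun y => ?_)
  · exact (hS.measurable.comp (measurable_const.prodMk measurable_id)).aestronglyMeasurable.mul
      (hm s hs).exp.aestronglyMeasurable
  · rw [norm_mul, Real.norm_eq_abs, Real.norm_eq_abs, Real.abs_exp]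
    have h1 := hc y
    have := (abs_nonneg _).trans h1
    have h2 := Real.exp_le_exp.2 (hle s hs y)
    gcongr
  · exact continuousOn_const.mul (hcont y).rexp

end truncation

/-! ### Global existence for the untruncated kernel -/

section existence

variable {A η : ℝ} {S : ℝ → ℝ → ℝ} {ν : Measure ℝ} [IsFiniteMeasure ν]

/-- The flows of the truncated kernels form a Cauchy sequence in the Hellinger distance. -/
theorem exists_hellinger_le (hS : IsKernel A η S) (hν : IsDatum η ν) {h : ℕ → ℝ → ℝ → ℝ}
    (hh : ∀ n, IsFlow (truncation S n) ν (n + 1) (h n)) {t : ℝ} (ht : 0 ≤ t) {ε : ℝ}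
    (hε : 0 < ε) : ∃ n₀ : ℕ, ∀ n ≥ n₀, ∀ m ≥ n, hellinger ν (h n t) (h m t) ≤ ε := by
  set B := A * ∫ x, Real.exp (η * x) ∂ν with hB
  have hB0 : 0 ≤ B := mul_nonneg hS.A_nonneg (integral_nonneg fun x => (Real.exp_pos _).le)
  set J := ∫ x, Real.exp ((t * B + 1 + (B * t + 1)) * singularWeight x) ∂ν with hJ
  have hJ0 : 0 ≤ J := integral_nonneg fun x => (Real.exp_pos _).le
  -- The height `N` is fixed first, to make the tail small; the truncation index comes afterwards,
  -- because the kernel error is multiplied by `e^{BNt}`.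
  obtain ⟨N, hN0, hN⟩ : ∃ N : ℝ, 0 ≤ N ∧ t * (B * (2 * J)) * Real.exp (-N) ≤ ε / 2 := by
    have h1 : Filter.Tendsto (fun N : ℝ => t * (B * (2 * J)) * Real.exp (-N)) Filter.atTop
        (nhds (t * (B * (2 * J)) * 0)) :=
      (Real.tendsto_exp_atBot.comp Filter.tendsto_neg_atTop_atBot).const_mul _
    rw [mul_zero] at h1
    obtain ⟨N, h2, h3⟩ := ((h1.eventually_le_const (half_pos hε)).and
      (Filter.eventually_ge_atTop 0)).exists
    exact ⟨N, h3, h2⟩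
  have hE := ((hS.tendsto_integral_sub_truncation hν (t * B)).const_mul
    (t * Real.exp (B * N * t)))
  rw [mul_zero] at hE
  obtain ⟨n₁, hn₁⟩ := Filter.eventually_atTop.1 (hE.eventually_le_const (half_pos hε))
  refine ⟨max n₁ ⌈t⌉₊, fun n hn m hm => ?_⟩
  have htn : t ≤ n := (Nat.le_ceil t).trans (by exact_mod_cast (le_max_right _ _).trans hn)
  have hnm : (n : ℝ) ≤ m := by exact_mod_cast hm
  obtain ⟨Λ₁, hΛ₁⟩ := hS.exists_abs_truncation_le n
  obtain ⟨Λ₂, hΛ₂⟩ := hS.exists_abs_truncation_le m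
  -- The later flow is restricted to the time interval of the earlier one, as the stability estimate
  -- needs a common interval.
  have h₂ : IsFlow (truncation S m) ν (n + 1) (h m) :=
    { measurable := (hh m).measurable
      zero := (hh m).zero
      bdd := by
        obtain ⟨c, hc⟩ := (hh m).bdd
        exact ⟨c, fun s hs => hc s ⟨by linarith [hs.1], by linarith [hs.2]⟩⟩
      hasDerivAt := fun s hs => (hh m).hasDerivAt s ⟨by linarith [hs.1], by linarith [hs.2]⟩
      mass := fun s hs => (hh m).mass s ⟨by linarith [hs.1], by linarith [hs.2]⟩ }
  have key := IsFlow.hellinger_le (hS.truncation n) (hS.truncation m) hΛ₁ hΛ₂ hν (hh n) h₂ hB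
    (t := t) ⟨ht, by linarith⟩ hN0
  rw [← hJ] at key
  have hexp : Real.exp (-((B * t + 1) * N)) * Real.exp (B * N * t) = Real.exp (-N) := by
    rw [← Real.exp_add]
    ring_nf
  have hmono : ∫ z, |truncation S n z.1 z.2 - truncation S m z.1 z.2| *
      (Real.exp (t * B * singularWeight z.1) * Real.exp (t * B * singularWeight z.2))
        ∂(ν.prod ν) ≤ ∫ z, |S z.1 z.2 - truncation S n z.1 z.2| *
      (Real.exp (t * B * singularWeight z.1) * Real.exp (t * B * singularWeight z.2))
        ∂(ν.prod ν) := by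
    have hE : Measurable fun x => Real.exp (t * B * singularWeight x) :=
      (measurable_singularWeight.const_mul _).exp
    refine integral_mono_of_nonneg (ae_of_all _ fun z => by positivity)
      ((hS.integrable_abs_mul_exp hν (t * B)).mono' ?_ (ae_of_all _ fun z => ?_))
      (ae_of_all _ fun z => mul_le_mul_of_nonneg_right
        (abs_truncation_sub_truncation_le S hm _ _) (by positivity))
    · have := (hS.measurable.sub (hS.truncation n).measurable).abs
      exact (this.mul ((hE.comp measurable_fst).mul (hE.comp measurable_snd))).aestronglyMeasurable
    · rw [Real.norm_eq_abs, abs_of_nonneg (by positivity)]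
      exact mul_le_mul_of_nonneg_right (abs_sub_truncation_le S n _ _) (by positivity)
  have h1 := hn₁ n ((le_max_left _ _).trans hn)
  have h2 := mul_le_mul_of_nonneg_left hmono
    (mul_nonneg ht (Real.exp_pos (B * N * t)).le)
  calc _ ≤ _ := key
    _ = t * (B * (2 * J)) * (Real.exp (-((B * t + 1) * N)) * Real.exp (B * N * t)) +
        t * Real.exp (B * N * t) * ∫ z, |truncation S n z.1 z.2 - truncation S m z.1 z.2| *
      (Real.exp (t * B * singularWeight z.1) * Real.exp (t * B * singularWeight z.2))
        ∂(ν.prod ν) := by ring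
    _ ≤ ε := by
        rw [hexp]
        linarith

theorem exists_integral_abs_sub_le (hS : IsKernel A η S) (hν : IsDatum η ν)
    {h : ℕ → ℝ → ℝ → ℝ} (hh : ∀ n, IsFlow (truncation S n) ν (n + 1) (h n)) {t : ℝ}
    (ht : 0 ≤ t) {ε : ℝ} (hε : 0 < ε) : ∃ n₀ : ℕ, ∀ n ≥ n₀, ∀ m ≥ n,
      ∫ x, |Real.exp (h n t x) - Real.exp (h m t x)| ∂ν ≤ ε := by
  set M := ν.real univ with hM
  have hM0 : 0 ≤ M := measureReal_nonneg
  set l := 4 * (M + 1) / ε with hl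
  have hl0 : 0 < l := by positivity
  obtain ⟨n₀, hn₀⟩ := exists_hellinger_le hS hν hh ht (ε := ε / l) (by positivity)
  refine ⟨max n₀ ⌈t⌉₊, fun n hn m hm => ?_⟩
  have htn : t ≤ n := (Nat.le_ceil t).trans (by exact_mod_cast (le_max_right _ _).trans hn)
  have hnm : (n : ℝ) ≤ m := by exact_mod_cast hm
  have h1 : t ∈ Ioo (-(n + 1 : ℝ)) (n + 1) := ⟨by linarith, by linarith⟩
  have h2 : t ∈ Ioo (-(m + 1 : ℝ)) (m + 1) := ⟨by linarith, by linarith⟩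
  refine (integral_abs_exp_sub_le ((hh n).measurable t) ((hh m).measurable t)
    ((hh n).integrable_exp h1) ((hh m).integrable_exp h2) hl0).trans ?_
  rw [(hh n).mass t h1, (hh m).mass t h2, ← hM]
  have h3 := mul_le_mul_of_nonneg_left (hn₀ n ((le_max_left _ _).trans hn) m hm)
    (by positivity : 0 ≤ l / 2)
  have h4 : l / 2 * (ε / l) = ε / 2 := by field_simp
  have h5 : (M + M) / l ≤ ε / 2 := by
    rw [hl, div_le_iff₀ (by positivity)]
    field_simp
    linarith
  linarith

/-- `h` is the logarithm of the density, with respect to `ν`, of a solution on `[0, ∞)` of the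
evolution equation with kernel `S` and initial datum `ν`. -/
structure IsGlobalFlow (A η : ℝ) (S : ℝ → ℝ → ℝ) (ν : Measure ℝ) (h : ℝ → ℝ → ℝ) : Prop where
  measurable : ∀ t ≥ 0, Measurable (h t)
  le : ∀ t ≥ 0, ∀ x, h t x ≤ t * (A * ∫ y, Real.exp (η * y) ∂ν) * singularWeight x
  mass : ∀ t ≥ 0, ∫ x, Real.exp (h t x) ∂ν = ν.real univ
  moment_le : ∀ t ≥ 0, ∫ x, Real.exp (η * x) * Real.exp (h t x) ∂ν ≤ ∫ x, Real.exp (η * x) ∂ν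
  eq_integral : ∀ t ≥ 0, ∀ x, h t x = ∫ s in (0 : ℝ)..t, rate S ν (h s) x
  continuousOn : ∀ x, ContinuousOn (fun s => h s x) (Ici 0)

/-- At each point the row of `S` is bounded, so `L¹` convergence of the densities makes the rates
converge there. Integrating in time, with the row bound times the mass as domination, gives
pointwise convergence of the logarithms. The uniform bound by the singular weight then passes the
mass, the moment and the rate to the limit. Neither subsequences nor exceptional null sets occur. -/
theorem exists_isGlobalFlow (hS : IsKernel A η S) (hν : IsDatum η ν) :
    ∃ h, IsGlobalFlow A η S ν h := by
  have hη := hS.η_nonneg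
  set B := A * ∫ x, Real.exp (η * x) ∂ν with hB
  have hB0 : 0 ≤ B := mul_nonneg hS.A_nonneg (integral_nonneg fun x => (Real.exp_pos _).le)
  choose Λ hΛ using hS.exists_abs_truncation_le
  have hex : ∀ n : ℕ, ∃ h, IsFlow (truncation S n) ν (n + 1) h := fun n =>
    exists_isFlow (hS.truncation n).measurable (hS.truncation n).antisymm (hΛ n)
      (by positivity)
  choose h hh using hex
  choose c hc using hS.bddRow
  have hc0 : ∀ x, 0 ≤ c x := fun x => (abs_nonneg _).trans (hc x 0)
  have hev : ∀ t : ℝ, 0 ≤ t → ∀ᶠ n : ℕ in Filter.atTop, t ≤ n := fun t _ =>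
    tendsto_natCast_atTop_atTop.eventually_ge_atTop t
  have hIoo : ∀ {t : ℝ} {n : ℕ}, 0 ≤ t → t ≤ n → t ∈ Ioo (-(n + 1 : ℝ)) (n + 1) :=
    fun h0 h1 => ⟨by linarith, by linarith⟩
  have hle : ∀ {t : ℝ} {n : ℕ}, 0 ≤ t → t ≤ n → ∀ x, h n t x ≤ t * B * singularWeight x :=
    fun {t n} h0 h1 x =>
      (hh n).le_mul_singularWeight (hS.truncation n) (hΛ n) hν ⟨h0, by linarith⟩ x
  have hD : ∀ r : ℝ, Integrable (fun x => Real.exp (r * singularWeight x)) ν :=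
    hν.integrable_exp_singular
  -- convergence of the rates
  have hcauchy : ∀ t ≥ 0, ∀ x, CauchySeq fun n => rate S ν (h n t) x := by
    intro t ht x
    refine Metric.cauchySeq_iff'.2 fun ε hε => ?_
    obtain ⟨n₀, hn₀⟩ := exists_integral_abs_sub_le hS hν hh ht
      (ε := ε / (2 * (c x + 1))) (by have := hc0 x; positivity)
    refine ⟨max n₀ ⌈t⌉₊, fun m hm => ?_⟩
    set n := max n₀ ⌈t⌉₊ with hn
    have htn : t ≤ n := (Nat.le_ceil t).trans (by exact_mod_cast le_max_right _ _)
    have htm : t ≤ m := htn.trans (by exact_mod_cast hm)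
    have hi₁ := (hh n).integrable_exp (hIoo ht htn)
    have hi₂ := (hh m).integrable_exp (hIoo ht htm)
    rw [dist_comm, Real.dist_eq, rate, rate, ← integral_sub (hS.integrable_row hi₁ x)
      (hS.integrable_row hi₂ x)]
    have h1 : |∫ y, (S x y * Real.exp (h n t y) - S x y * Real.exp (h m t y)) ∂ν| ≤
        ∫ y, c x * |Real.exp (h n t y) - Real.exp (h m t y)| ∂ν := by
      rw [← Real.norm_eq_abs]
      refine norm_integral_le_of_norm_le ((hi₁.sub hi₂).abs.const_mul _) (ae_of_all _ fun y => ?_)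
      rw [← mul_sub, Real.norm_eq_abs, abs_mul]
      exact mul_le_mul_of_nonneg_right (hc x y) (abs_nonneg _)
    rw [integral_const_mul] at h1
    have h2 := mul_le_mul_of_nonneg_left (hn₀ n (le_max_left _ _) m hm) (hc0 x)
    have h3 : c x * (ε / (2 * (c x + 1))) < ε := by
      have := hc0 x
      rw [mul_div_assoc', div_lt_iff₀ (by positivity)]
      nlinarith
    linarith
  have hlim : ∀ t x, ∃ G, 0 ≤ t → Filter.Tendsto (fun n => rate S ν (h n t) x) Filter.atTop
      (nhds G) := by
    intro t x
    by_cases ht : 0 ≤ t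
    · obtain ⟨G, hG⟩ := cauchySeq_tendsto_of_complete (hcauchy t ht x)
      exact ⟨G, fun _ => hG⟩
    · exact ⟨0, fun h => absurd h ht⟩
  choose G hG using hlim
  have hG' : ∀ t ≥ 0, ∀ x, Filter.Tendsto (fun n => rate (truncation S n) ν (h n t) x)
      Filter.atTop (nhds (G t x)) := by
    intro t ht x
    have h0 : Filter.Tendsto (fun n => rate S ν (h n t) x - rate (truncation S n) ν (h n t) x)
        Filter.atTop (nhds 0) := by
      refine squeeze_zero_norm' ?_ (hS.tendsto_integral_row_sub_truncation (hD (t * B)) x)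
      filter_upwards [hev t ht] with n hn
      have hi := (hh n).integrable_exp (hIoo ht hn)
      rw [rate, rate, ← integral_sub (hS.integrable_row hi x)
        ((hS.truncation n).integrable_row hi x)]
      refine norm_integral_le_of_norm_le ?_ (ae_of_all _ fun y => ?_)
      · have h1 := (hS.integrable_row (hD (t * B)) x).sub
          ((hS.truncation n).integrable_row (hD (t * B)) x)
        refine h1.abs.congr (ae_of_all _ fun y => ?_)
        simp only [Pi.sub_apply, ← sub_mul, abs_mul, Real.abs_exp]
      · rw [← sub_mul, Real.norm_eq_abs, abs_mul, Real.abs_exp]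
        exact mul_le_mul_of_nonneg_left (Real.exp_le_exp.2 (hle ht hn y)) (abs_nonneg _)
    simpa using (hG t x ht).sub h0
  -- convergence of the logarithms
  have hrow : ∀ {t : ℝ} {n : ℕ}, 0 ≤ t → t ≤ n → ∀ x,
      |rate (truncation S n) ν (h n t) x| ≤ c x * ν.real univ := fun {t n} h0 h1 x =>
    (hh n).abs_rate_le_row (fun y => (abs_truncation_le S n x y).trans (hc x y)) (hIoo h0 h1)
  have hcontn : ∀ {t : ℝ} {n : ℕ}, t ≤ n → ∀ x,
      ContinuousOn (fun s => rate (truncation S n) ν (h n s) x) (Icc 0 t) := by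
    intro t n htn x
    obtain ⟨b, hb⟩ := (hh n).bdd
    refine continuousOn_rate (fun s _ => (hh n).measurable s) (hS.truncation n) (fun x s hs => ?_)
      (b := fun _ => b) (integrable_const _) (fun s hs x => ?_) x
    · exact ((hh n).hasDerivAt s (hIoo hs.1 (hs.2.trans htn)) x).continuousAt.continuousWithinAt
    · exact (le_abs_self _).trans (hb s (hIoo hs.1 (hs.2.trans htn)) x)
  have hFTC : ∀ {t : ℝ} {n : ℕ}, 0 ≤ t → t ≤ n → ∀ x,
      ∫ s in (0 : ℝ)..t, rate (truncation S n) ν (h n s) x = h n t x := by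
    intro t n h0 h1 x
    have hc' := hcontn h1 x
    rw [← uIcc_of_le h0] at hc'
    rw [intervalIntegral.integral_eq_sub_of_hasDerivAt (f := fun s => h n s x) (fun s hs => ?_)
      hc'.intervalIntegrable, (hh n).zero, sub_zero]
    rw [uIcc_of_le h0] at hs
    exact (hh n).hasDerivAt s (hIoo hs.1 (hs.2.trans h1)) x
  set H : ℝ → ℝ → ℝ := fun t x => ∫ s in (0 : ℝ)..t, G s x with hH
  have hHlim : ∀ t ≥ 0, ∀ x, Filter.Tendsto (fun n => h n t x) Filter.atTop (nhds (H t x)) := by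
    intro t ht x
    have h1 := intervalIntegral.tendsto_integral_filter_of_dominated_convergence
      (μ := volume) (a := 0) (b := t) (l := Filter.atTop)
      (F := fun n s => rate (truncation S n) ν (h n s) x) (f := fun s => G s x)
      (fun _ => c x * ν.real univ) (by
        filter_upwards [hev t ht] with n hn
        rw [uIoc_of_le ht]
        exact ((hcontn hn x).mono Ioc_subset_Icc_self).aestronglyMeasurable measurableSet_Ioc)
      (by
        filter_upwards [hev t ht] with n hn
        refine ae_of_all _ fun s hs => ?_
        rw [uIoc_of_le ht] at hs
        exact hrow hs.1.le (hs.2.trans hn) x)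
      intervalIntegrable_const
      (ae_of_all _ fun s hs => by
        rw [uIoc_of_le ht] at hs
        exact hG' s hs.1.le x)
    refine h1.congr' ?_
    filter_upwards [hev t ht] with n hn using hFTC ht hn x
  have hHm : ∀ t ≥ 0, Measurable (H t) := fun t ht =>
    measurable_of_tendsto_metrizable (fun n => (hh n).measurable t)
      (tendsto_pi_nhds.2 fun x => hHlim t ht x)
  have hHle : ∀ t ≥ 0, ∀ x, H t x ≤ t * B * singularWeight x := by
    intro t ht x
    refine le_of_tendsto (hHlim t ht x) ?_
    filter_upwards [hev t ht] with n hn using hle ht hn x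
  have hdom : ∀ t ≥ 0, ∀ {φ : ℝ → ℝ}, AEStronglyMeasurable φ ν →
      Integrable (fun x => φ x * Real.exp (t * B * singularWeight x)) ν →
      Filter.Tendsto (fun n => ∫ x, φ x * Real.exp (h n t x) ∂ν) Filter.atTop
        (nhds (∫ x, φ x * Real.exp (H t x) ∂ν)) := by
    intro t ht φ hφ hi
    refine tendsto_integral_filter_of_dominated_convergence _ (Filter.Eventually.of_forall
      fun n => hφ.mul ((hh n).measurable t).exp.aestronglyMeasurable) ?_ hi.abs
      (ae_of_all _ fun x => ((hHlim t ht x).rexp).const_mul _)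
    filter_upwards [hev t ht] with n hn
    refine ae_of_all _ fun x => ?_
    rw [norm_mul, abs_mul, Real.norm_eq_abs, Real.norm_eq_abs, Real.abs_exp, Real.abs_exp]
    exact mul_le_mul_of_nonneg_left (Real.exp_le_exp.2 (hle ht hn x)) (abs_nonneg _)
  have hGH : ∀ t ≥ 0, ∀ x, G t x = rate S ν (H t) x := by
    intro t ht x
    exact tendsto_nhds_unique (hG t x ht) (hdom t ht
      (hS.measurable.comp (measurable_const.prodMk measurable_id)).aestronglyMeasurable
      (hS.integrable_row (hD (t * B)) x))
  refine ⟨H, hHm, hHle, fun t ht => ?_, fun t ht => ?_, fun t ht x => ?_, fun x => ?_⟩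
  · have h1 := hdom t ht (φ := fun _ => 1) aestronglyMeasurable_const
      (by simpa using hD (t * B))
    simp only [one_mul] at h1
    refine tendsto_nhds_unique h1 (tendsto_const_nhds.congr' ?_)
    filter_upwards [hev t ht] with n hn using ((hh n).mass t (hIoo ht hn)).symm
  · have h1 := hdom t ht (φ := fun x => Real.exp (η * x))
      (measurable_id.const_mul η).exp.aestronglyMeasurable
      ((hν.integrable_weight hη (t * B)).congr (ae_of_all _ fun x => mul_comm _ _))
    refine le_of_tendsto h1 ?_
    filter_upwards [hev t ht] with n hn using
      (hh n).moment_le (hS.truncation n) (hΛ n) hν ⟨ht, by linarith⟩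
  · refine intervalIntegral.integral_congr fun s hs => ?_
    rw [uIcc_of_le ht] at hs
    exact hGH s hs.1 x
  · have hlip : LipschitzOnWith (Real.toNNReal (c x * ν.real univ)) (fun s => H s x) (Ici 0) := by
      refine LipschitzOnWith.of_dist_le_mul fun s hs t ht => ?_
      rw [Real.coe_toNNReal _ (mul_nonneg (hc0 x) measureReal_nonneg)]
      refine le_of_tendsto ((hHlim s hs x).dist (hHlim t ht x)) ?_
      filter_upwards [hev s hs, hev t ht] with n hns hnt
      have hconv := (convex_Icc (0 : ℝ) n).norm_image_sub_le_of_norm_hasDerivWithin_le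
        (f := fun s => h n s x) (f' := fun s => rate (truncation S n) ν (h n s) x)
        (C := c x * ν.real univ)
        (fun u hu => ((hh n).hasDerivAt u (hIoo hu.1 hu.2) x).hasDerivWithinAt)
        (fun u hu => hrow hu.1 hu.2 x) (x := t) (y := s) ⟨ht, hnt⟩ ⟨hs, hns⟩
      rwa [← dist_eq_norm, ← dist_eq_norm] at hconv
    exact hlip.continuousOn

end existence

/-! ### Bounds for the redistribution function -/

section redistribution

variable {β m : ℝ}

/-- The angular integrand of the redistribution function. -/
noncomputable def angularIntegrand (β m k k' t : ℝ) : ℝ :=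
  (1 + t ^ 2) / momentumTransfer k k' t *
    Real.exp (-β * (((k' - k) ^ 2 + m ^ 2 * (momentumTransfer k k' t / m) ^ 4 / 4) /
      (2 * m * (momentumTransfer k k' t / m) ^ 2)))

theorem redistribution_eq (β m k k' : ℝ) : redistribution β m k k' =
    √β * Real.exp (β * (k' + k) / 2) *
      ∫ t, angularIntegrand β m k k' t ∂volume.restrict (Ioo (-1 : ℝ) 1) := by
  rw [redistribution, intervalIntegral.integral_of_le (by norm_num), integral_Ioc_eq_integral_Ioo]
  rfl

theorem angularIntegrand_nonneg (β m k k' t : ℝ) : 0 ≤ angularIntegrand β m k k' t := by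
  unfold angularIntegrand momentumTransfer
  positivity

theorem redistribution_nonneg (β m k k' : ℝ) : 0 ≤ redistribution β m k k' := by
  rw [redistribution_eq]
  have := integral_nonneg (μ := volume.restrict (Ioo (-1 : ℝ) 1))
    (f := angularIntegrand β m k k') (fun t => angularIntegrand_nonneg β m k k' t)
  positivity

theorem momentumTransfer_comm (k k' t : ℝ) :
    momentumTransfer k k' t = momentumTransfer k' k t := by
  unfold momentumTransfer
  congr 1
  ring

theorem redistribution_comm (β m k k' : ℝ) :
    redistribution β m k k' = redistribution β m k' k := by
  simp only [redistribution, momentumTransfer_comm k k', add_comm k k',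
    show (k' - k) ^ 2 = (k - k') ^ 2 by ring]

theorem measurable_angularIntegrand (β m : ℝ) :
    Measurable fun q : (ℝ × ℝ) × ℝ => angularIntegrand β m q.1.1 q.1.2 q.2 := by
  unfold angularIntegrand momentumTransfer
  fun_prop

theorem measurable_redistribution (β m : ℝ) :
    Measurable fun p : ℝ × ℝ => redistribution β m p.1 p.2 := by
  simp only [redistribution_eq]
  refine Measurable.mul (by fun_prop) ?_
  exact (measurable_angularIntegrand β m).stronglyMeasurable.integral_prod_right'.measurable

/-- The squares differ by `(1 + t) (k - k')² / 2`. -/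
theorem momentumTransfer_mean_le {t : ℝ} (k k' : ℝ) (ht : -1 ≤ t) :
    momentumTransfer ((k + k') / 2) ((k + k') / 2) t ≤ momentumTransfer k k' t := by
  refine Real.sqrt_le_sqrt ?_
  nlinarith [mul_nonneg (sq_nonneg (k - k')) (by linarith : 0 ≤ 1 + t)]

theorem momentumTransfer_self {k t : ℝ} (hk : 0 ≤ k) :
    momentumTransfer k k t = k * (√2 * √(1 - t)) := by
  rw [momentumTransfer, show k ^ 2 + k ^ 2 - 2 * k * k * t = k ^ 2 * (2 * (1 - t)) by ring,
    Real.sqrt_mul (sq_nonneg k), Real.sqrt_sq hk, Real.sqrt_mul zero_le_two]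

/-- The exponent splits into `(k' - k)² / (2mw²) + d² / (8m)`. Moving to the diagonal with `k + k'`
fixed removes the first term and decreases `d`, so both the exponential and `1 / d` increase. -/
theorem angularIntegrand_le (hβ : 0 < β) (hm : 0 < m) {k k' t : ℝ} (hk : 0 < k + k')
    (ht : t ∈ Ioo (-1 : ℝ) 1) : angularIntegrand β m k k' t ≤
      angularIntegrand β m ((k + k') / 2) ((k + k') / 2) t := by
  have h0 : 0 < momentumTransfer ((k + k') / 2) ((k + k') / 2) t := by
    rw [momentumTransfer_self (by positivity)]
    have : 0 < 1 - t := by linarith [ht.2]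
    positivity
  have h1 := momentumTransfer_mean_le k k' ht.1.le
  unfold angularIntegrand
  set d := momentumTransfer k k' t
  set d₀ := momentumTransfer ((k + k') / 2) ((k + k') / 2) t
  have hd : 0 < d := h0.trans_le h1
  have e0 : (((k + k') / 2 - (k + k') / 2) ^ 2 + m ^ 2 * (d₀ / m) ^ 4 / 4) /
      (2 * m * (d₀ / m) ^ 2) = d₀ ^ 2 / (8 * m) := by
    field_simp
    ring
  have e1 : ((k' - k) ^ 2 + m ^ 2 * (d / m) ^ 4 / 4) / (2 * m * (d / m) ^ 2) =
      (k' - k) ^ 2 / (2 * m * (d / m) ^ 2) + d ^ 2 / (8 * m) := by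
    field_simp
    ring
  rw [e0, e1]
  have h2 : d₀ ^ 2 / (8 * m) ≤ (k' - k) ^ 2 / (2 * m * (d / m) ^ 2) + d ^ 2 / (8 * m) := by
    have : d₀ ^ 2 / (8 * m) ≤ d ^ 2 / (8 * m) := by gcongr
    have : 0 ≤ (k' - k) ^ 2 / (2 * m * (d / m) ^ 2) := by positivity
    linarith
  gcongr ?_ * Real.exp ?_
  · gcongr
  · nlinarith

theorem integrable_one_sub_rpow :
    Integrable (fun t : ℝ => (1 - t) ^ (-1 / 2 : ℝ)) (volume.restrict (Ioo (-1 : ℝ) 1)) := by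
  have h : IntervalIntegrable (fun t : ℝ => t ^ (-1 / 2 : ℝ)) volume 2 0 :=
    intervalIntegral.intervalIntegrable_rpow' (by norm_num)
  have h2 := h.comp_sub_left 1
  norm_num at h2
  rw [intervalIntegrable_iff_integrableOn_Ioo_of_le (by norm_num)] at h2
  rw [show (-1 / 2 : ℝ) = -(1 / 2) by norm_num]
  exact h2

/-- On the diagonal `d = k √2 √(1 - t)`: forward scattering gives only an integrable singularity. -/
theorem angularIntegrand_self_le (hβ : 0 < β) (hm : 0 < m) {k t : ℝ} (hk : 0 < k)
    (ht : t ∈ Ioo (-1 : ℝ) 1) :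
    angularIntegrand β m k k t ≤ 2 / k * (1 - t) ^ (-1 / 2 : ℝ) := by
  have h1 : 0 < 1 - t := by linarith [ht.2]
  unfold angularIntegrand
  rw [momentumTransfer_self hk.le]
  have h2 : Real.exp (-β * (((k - k) ^ 2 + m ^ 2 * (k * (√2 * √(1 - t)) / m) ^ 4 / 4) /
      (2 * m * (k * (√2 * √(1 - t)) / m) ^ 2))) ≤ 1 := by
    rw [Real.exp_le_one_iff, neg_mul, neg_nonpos]
    positivity
  have h3 : (1 - t) ^ (-1 / 2 : ℝ) = (√(1 - t))⁻¹ := by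
    rw [Real.sqrt_eq_rpow, ← Real.rpow_neg h1.le]
    norm_num
  have h4 : 1 + t ^ 2 ≤ 2 := by nlinarith [ht.1, ht.2]
  have h5 : 1 ≤ √2 := Real.one_le_sqrt.2 one_le_two
  have h6 : 0 < √(1 - t) := Real.sqrt_pos.2 h1
  calc _ ≤ (1 + t ^ 2) / (k * (√2 * √(1 - t))) * 1 := by gcongr
    _ ≤ 2 / (k * (1 * √(1 - t))) * 1 := by gcongr
    _ = _ := by
      rw [h3]
      field_simp

theorem integrable_angularIntegrand_self (hβ : 0 < β) (hm : 0 < m) {k : ℝ} (hk : 0 < k) :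
    Integrable (angularIntegrand β m k k) (volume.restrict (Ioo (-1 : ℝ) 1)) := by
  refine (integrable_one_sub_rpow.const_mul (2 / k)).mono' ?_ ?_
  · have h : Measurable fun t : ℝ => ((k, k), t) := by fun_prop
    have h2 : Measurable (angularIntegrand β m k k) := (measurable_angularIntegrand β m).comp h
    exact h2.aestronglyMeasurable
  · filter_upwards [ae_restrict_mem measurableSet_Ioo] with t ht
    rw [Real.norm_eq_abs, abs_of_nonneg (angularIntegrand_nonneg _ _ _ _ _)]
    exact angularIntegrand_self_le hβ hm hk ht

theorem redistribution_le_mean (hβ : 0 < β) (hm : 0 < m) {k k' : ℝ} (hk : 0 < k + k') :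
    redistribution β m k k' ≤ redistribution β m ((k + k') / 2) ((k + k') / 2) := by
  rw [redistribution_eq, redistribution_eq,
    show β * ((k + k') / 2 + (k + k') / 2) / 2 = β * (k' + k) / 2 by ring]
  refine mul_le_mul_of_nonneg_left ?_ (by positivity)
  refine integral_mono_of_nonneg (ae_of_all _ fun t => angularIntegrand_nonneg _ _ _ _ _)
    (integrable_angularIntegrand_self hβ hm (by positivity)) ?_
  filter_upwards [ae_restrict_mem measurableSet_Ioo] with t ht
  exact angularIntegrand_le hβ hm hk ht

theorem redistribution_mean_le (hβ : 0 < β) (hm : 0 < m) {k k' : ℝ} (hk : 0 < k + k') :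
    redistribution β m ((k + k') / 2) ((k + k') / 2) ≤
      (4 * √β * ∫ t, (1 - t) ^ (-1 / 2 : ℝ) ∂volume.restrict (Ioo (-1 : ℝ) 1)) *
        Real.exp (β * (k + k') / 2) / (k + k') := by
  rw [redistribution_eq,
    show β * ((k + k') / 2 + (k + k') / 2) / 2 = β * (k + k') / 2 by ring]
  have h : ∫ t, angularIntegrand β m ((k + k') / 2) ((k + k') / 2) t
      ∂volume.restrict (Ioo (-1 : ℝ) 1) ≤
      2 / ((k + k') / 2) * ∫ t, (1 - t) ^ (-1 / 2 : ℝ) ∂volume.restrict (Ioo (-1 : ℝ) 1) := by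
    rw [← integral_const_mul]
    refine integral_mono_ae (integrable_angularIntegrand_self hβ hm (by positivity))
      (integrable_one_sub_rpow.const_mul _) ?_
    filter_upwards [ae_restrict_mem measurableSet_Ioo] with t ht
    exact angularIntegrand_self_le hβ hm (by positivity) ht
  refine (mul_le_mul_of_nonneg_left h (by positivity)).trans (le_of_eq ?_)
  field_simp
  ring

end redistribution

/-! ### Geometry of the support of the cutoff -/

section region

variable {θ δ : ℝ}

theorem add_pos_of_mem_region {ρ : ℝ} {k k' : ℝ} (h : (k, k') ∈ region θ δ ρ)
    (h0 : (k, k') ≠ (0, 0)) : 0 < k + k' := by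
  have hk : 0 ≤ k ∧ 0 ≤ k' := by
    rcases h with h | h
    · exact ⟨h.1.1.1, h.1.2.1⟩
    · exact ⟨h.1.1.1, h.1.1.2⟩
  rcases hk.1.eq_or_lt with h1 | h1
  · rcases hk.2.eq_or_lt with h2 | h2
    · exact absurd (by rw [← h1, ← h2]) h0
    · linarith
  · linarith

theorem diag_mem_region {θ₁ ρ₁ : ℝ} (hθ : θ₁ ∈ Ioo (0 : ℝ) 1) (hρ : 0 < ρ₁) {k : ℝ}
    (hk : 0 ≤ k) : (k, k) ∈ region θ₁ δ ρ₁ := by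
  by_cases h : k ≤ δ
  · refine Or.inl ⟨⟨⟨hk, h⟩, ⟨hk, h⟩⟩, ?_⟩
    simp only [sub_self, abs_zero]
    positivity
  · refine Or.inr ⟨⟨⟨hk, hk⟩, fun h' => h h'.1.2⟩, ?_, ?_⟩
    · exact mul_le_of_le_one_left hk hθ.2.le
    · exact le_mul_of_one_le_left hk ((one_le_inv₀ hθ.1).2 hθ.2.le)

/-- Since `Φ ≤ 1` everywhere and `Φ = 1` on the diagonal, the truncated function inherits the bounds
of the full one. -/
theorem exists_isKernelConstant {β m : ℝ} (hβ : 0 < β) (hm : 0 < m) (hθ : θ ∈ Ioo (0 : ℝ) 1)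
    {Φ : ℝ → ℝ → ℝ} (hΦ : IsCutoff θ δ Φ) : ∃ C, IsKernelConstant β m θ δ Φ C := by
  obtain ⟨θ₁, hθ₁, ρ₁, hρ₁, h1⟩ := hΦ.eq_one
  have hI : 0 ≤ ∫ t, (1 - t) ^ (-1 / 2 : ℝ) ∂volume.restrict (Ioo (-1 : ℝ) 1) := by
    refine integral_nonneg_of_ae ?_
    filter_upwards [ae_restrict_mem measurableSet_Ioo] with t ht
    exact Real.rpow_nonneg (by linarith [ht.2]) _
  -- Adding `1` makes the constant positive without evaluating the integral.
  refine ⟨4 * √β * (∫ t, (1 - t) ^ (-1 / 2 : ℝ) ∂volume.restrict (Ioo (-1 : ℝ) 1)) + 1,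
    by positivity, fun k k' hk h0 => ?_⟩
  have hpos := add_pos_of_mem_region hk h0
  have hdiag : Φ ((k + k') / 2) ((k + k') / 2) = 1 :=
    h1 ((k + k') / 2, (k + k') / 2)
      (diag_mem_region ⟨hθ.1.trans hθ₁.1, hθ₁.2⟩ hρ₁ (by positivity))
  have hkk : 0 ≤ k ∧ 0 ≤ k' := by
    rcases hk with h | h
    · exact ⟨h.1.1.1, h.1.2.1⟩
    · exact ⟨h.1.1.1, h.1.1.2⟩
  simp only [truncated, hdiag, one_mul]
  refine ⟨?_, (redistribution_mean_le hβ hm hpos).trans ?_⟩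
  · exact (mul_le_of_le_one_left (redistribution_nonneg _ _ _ _)
      (hΦ.mem_Icc k hkk.1 k' hkk.2).2).trans (redistribution_le_mean hβ hm hpos)
  · gcongr
    linarith

theorem mem_region_of_ne_zero {Φ : ℝ → ℝ → ℝ} (hΦ : IsCutoff θ δ Φ) {k k' : ℝ} (hk : 0 ≤ k)
    (hk' : 0 ≤ k') (h : Φ k k' ≠ 0) : (k, k') ∈ region θ δ (rhoStar θ δ) := by
  rw [← hΦ.support_eq]
  exact subset_closure ⟨⟨hk, hk'⟩, h⟩

theorem rhoStar_pos (hθ : θ ∈ Ioo (0 : ℝ) 1) (hδ : 0 < δ) : 0 < rhoStar θ δ := by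
  have h1 := hθ.1
  have h2 : 0 < 1 - θ := by linarith [hθ.2]
  unfold rhoStar
  positivity

/-- Outside the square this is the definition. Inside, `a < θb` would give `(b - a)² > (1 - θ)² b²`,
whereas `b ≤ δ` and the value of `ρ_*` give `(b - a)² θ(1 + θ) ≤ (1 - θ)² a(a + b) < (1 - θ)² θ(1 +
θ) b²`. -/
theorem mul_le_of_mem_region (hθ : θ ∈ Ioo (0 : ℝ) 1) (hδ : 0 < δ) {a b : ℝ} (ha : 0 < a)
    (hab : a ≤ b) (h : (a, b) ∈ region θ δ (rhoStar θ δ)) : θ * b ≤ a := by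
  have h1 := hθ.1
  have h2 : 0 < 1 - θ := by linarith [hθ.2]
  have hb : 0 < b := ha.trans_le hab
  rcases h with ⟨hsq, h⟩ | ⟨_, _, h⟩
  · by_contra! hlt
    have hbδ : b ≤ δ := hsq.2.2
    simp only [abs_sub_comm a b, abs_of_nonneg (sub_nonneg.2 hab)] at h
    have h3 := pow_le_pow_left₀ (sub_nonneg.2 hab) h 2
    rw [mul_pow, Real.sq_sqrt (by positivity), rhoStar, div_pow, Real.sq_sqrt (by positivity),
      div_mul_eq_mul_div, le_div_iff₀ (by positivity)] at h3
    have h4 : (b - a) ^ 2 * (θ * (1 + θ)) ≤ (1 - θ) ^ 2 * (a * (a + b)) := by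
      refine le_of_mul_le_mul_right ?_ hδ
      calc (b - a) ^ 2 * (θ * (1 + θ)) * δ = (b - a) ^ 2 * (θ * (1 + θ) * δ) := by ring
        _ ≤ _ := h3
        _ = (1 - θ) ^ 2 * (a * (a + b)) * b := by ring
        _ ≤ _ := by gcongr
    have h5 : (1 - θ) * b ≤ b - a := by linarith
    have h6 : ((1 - θ) * b) ^ 2 ≤ (b - a) ^ 2 := by gcongr
    have h7 : a * (a + b) < θ * b * (θ * b + b) := by gcongr
    have h8 : ((1 - θ) * b) ^ 2 * (θ * (1 + θ)) ≤ (b - a) ^ 2 * (θ * (1 + θ)) := by gcongr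
    have h9 : (1 - θ) ^ 2 * (a * (a + b)) < (1 - θ) ^ 2 * (θ * b * (θ * b + b)) := by gcongr
    linarith
  · simp only at h
    rwa [inv_mul_eq_div, le_div_iff₀ h1, mul_comm] at h

theorem singularWeight_eq {x : ℝ} (hx : 0 < x) : singularWeight x = (x * √x)⁻¹ := by
  rw [singularWeight, abs_of_pos hx, show (3 / 2 : ℝ) = 1 + 1 / 2 by norm_num,
    Real.rpow_add hx, Real.rpow_one, Real.sqrt_eq_rpow]

/-- Inside the square, `b - a` is at most `ρ_*` times the root of the denominator, and `ab(a + b) ≥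
2a³ ≥ θ(1 + θ) a³`. Outside, `b > δ`, `b - a ≤ (1 - θ) b` and `a + b ≥ (1 + θ) b`; the value of
`ρ_*` makes the same constant serve. -/
theorem sub_div_le_of_mem_region (hθ : θ ∈ Ioo (0 : ℝ) 1) (hδ : 0 < δ) {a b : ℝ} (ha : 0 < a)
    (hab : a ≤ b) (h : (a, b) ∈ region θ δ (rhoStar θ δ)) :
    (b - a) / (a * b * (a + b)) ≤ rhoStar θ δ / √(θ * (1 + θ)) * singularWeight a := by
  have h1 := hθ.1
  have h2 : 0 < 1 - θ := by linarith [hθ.2]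
  have hb : 0 < b := ha.trans_le hab
  have hρ := rhoStar_pos hθ hδ
  have hθb := mul_le_of_mem_region hθ hδ ha hab h
  rw [singularWeight_eq ha]
  rcases h with ⟨hsq, h⟩ | ⟨hout, -, -⟩
  · simp only [abs_sub_comm a b, abs_of_nonneg (sub_nonneg.2 hab)] at h
    have hs : 0 < √(a * b * (a + b)) := by positivity
    have e : a * b * (a + b) = √(a * b * (a + b)) * √(a * b * (a + b)) :=
      (Real.mul_self_sqrt (by positivity)).symm
    have h3 : √(θ * (1 + θ)) * (a * √a) ≤ √(a * b * (a + b)) := by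
      refine Real.le_sqrt_of_sq_le ?_
      rw [mul_pow, mul_pow, Real.sq_sqrt (by positivity), Real.sq_sqrt ha.le]
      have h4 : θ * (1 + θ) ≤ 2 := by nlinarith [hθ.2]
      calc θ * (1 + θ) * (a ^ 2 * a) ≤ 2 * (a ^ 2 * a) := by gcongr
        _ = a * a * (a + a) := by ring
        _ ≤ _ := by gcongr
    calc (b - a) / (a * b * (a + b)) ≤
        rhoStar θ δ * √(a * b * (a + b)) / (a * b * (a + b)) := by gcongr
      _ = rhoStar θ δ / √(a * b * (a + b)) := by
        rw [div_eq_div_iff (by positivity) hs.ne', mul_assoc, ← e]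
      _ ≤ rhoStar θ δ / (√(θ * (1 + θ)) * (a * √a)) := by gcongr
      _ = _ := by rw [← div_div, div_eq_mul_inv (_ / _)]
  · have hbδ : δ < b := by
      by_contra! hle
      exact hout.2 ⟨⟨ha.le, hab.trans hle⟩, ⟨hb.le, hle⟩⟩
    have e : rhoStar θ δ / √(θ * (1 + θ)) = (1 - θ) / (θ * (1 + θ) * √δ) := by
      rw [rhoStar, Real.sqrt_mul (by positivity), div_div, mul_right_comm,
        Real.mul_self_sqrt (by positivity)]
    rw [e]
    have hsa : √a ≤ √b := Real.sqrt_le_sqrt hab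
    have hsb : √δ ≤ √b := Real.sqrt_le_sqrt hbδ.le
    have hsδ : 0 < √δ := Real.sqrt_pos.2 hδ
    have hsa0 : 0 < √a := Real.sqrt_pos.2 ha
    have hsb0 : 0 < √b := Real.sqrt_pos.2 hb
    have ebb : √b * √b = b := Real.mul_self_sqrt hb.le
    rw [← div_eq_mul_inv, div_div, div_le_div_iff₀ (by positivity) (by positivity)]
    have k1 : b - a ≤ (1 - θ) * b := by linarith
    have k2 : (1 + θ) * b ≤ a + b := by linarith
    have k3 : θ ≤ 1 := hθ.2.le
    calc (b - a) * (θ * (1 + θ) * √δ * (a * √a))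
        ≤ (1 - θ) * b * (1 * (1 + θ) * √b * (a * √b)) := by gcongr
      _ = (1 - θ) * (a * b * ((1 + θ) * (√b * √b))) := by ring
      _ ≤ _ := by
        rw [ebb]
        gcongr

end region

/-! ### Time regularity of the global flow -/

namespace IsGlobalFlow

variable {A η : ℝ} {S : ℝ → ℝ → ℝ} {ν : Measure ℝ} {h : ℝ → ℝ → ℝ}

theorem le_of_le (hh : IsGlobalFlow A η S ν h) (hA : 0 ≤ A) {t T : ℝ} (ht : t ∈ Icc 0 T) (x : ℝ) :
    h t x ≤ T * (A * ∫ y, Real.exp (η * y) ∂ν) * singularWeight x := by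
  refine (hh.le t ht.1 x).trans ?_
  have h1 : 0 ≤ ∫ y, Real.exp (η * y) ∂ν := integral_nonneg fun y => (Real.exp_pos _).le
  have := singularWeight_nonneg x
  have := ht.2
  gcongr

theorem integrable_exp (hh : IsGlobalFlow A η S ν h) (hν : IsDatum η ν) {t : ℝ} (ht : 0 ≤ t) :
    Integrable (fun x => Real.exp (h t x)) ν := by
  refine (hν.integrable_exp_singular (t * (A * ∫ y, Real.exp (η * y) ∂ν))).mono'
    (hh.measurable t ht).exp.aestronglyMeasurable (ae_of_all _ fun x => ?_)
  rw [Real.norm_eq_abs, Real.abs_exp]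
  exact Real.exp_le_exp.2 (hh.le t ht x)

theorem integrable_exp_mul_exp (hh : IsGlobalFlow A η S ν h) (hν : IsDatum η ν) (hη : 0 ≤ η)
    {t : ℝ} (ht : 0 ≤ t) : Integrable (fun x => Real.exp (η * x) * Real.exp (h t x)) ν := by
  refine (hν.integrable_weight hη (t * (A * ∫ y, Real.exp (η * y) ∂ν))).mono'
    ((measurable_id.const_mul η).exp.mul (hh.measurable t ht).exp).aestronglyMeasurable
    (ae_of_all _ fun x => ?_)
  rw [norm_mul, Real.norm_eq_abs, Real.norm_eq_abs, Real.abs_exp, Real.abs_exp, mul_comm]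
  exact mul_le_mul_of_nonneg_right (Real.exp_le_exp.2 (hh.le t ht x)) (Real.exp_pos _).le

theorem abs_rate_le (hh : IsGlobalFlow A η S ν h) (hS : IsKernel A η S) (hν : IsDatum η ν)
    {t T : ℝ} (ht : t ∈ Icc 0 T) (x : ℝ) :
    |rate S ν (h t) x| ≤ A * weight η 1 x *
      ∫ y, weight η (1 + T * (A * ∫ y, Real.exp (η * y) ∂ν)) y ∂ν := by
  rw [rate, ← integral_const_mul, ← Real.norm_eq_abs]
  refine norm_integral_le_of_norm_le ((hν.integrable_weight hS.η_nonneg _).const_mul _)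
    (ae_of_all _ fun y => ?_)
  rw [norm_mul, Real.norm_eq_abs, Real.norm_eq_abs, Real.abs_exp, weight_add]
  have h1 := hS.abs_le x y
  have h2 := Real.exp_le_exp.2 (hh.le_of_le hS.A_nonneg ht y)
  calc _ ≤ A * (weight η 1 x * weight η 1 y) *
        Real.exp (T * (A * ∫ y, Real.exp (η * y) ∂ν) * singularWeight y) := by
        have := (abs_nonneg _).trans h1
        gcongr
    _ = _ := by ring

theorem continuousOn_rate (hh : IsGlobalFlow A η S ν h) (hS : IsKernel A η S) (hν : IsDatum η ν)
    (x : ℝ) : ContinuousOn (fun s => rate S ν (h s) x) (Ici 0) := by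
  have h1 : ∀ T, ContinuousOn (fun s => rate S ν (h s) x) (Icc 0 T) := fun T =>
    Compton.continuousOn_rate (fun t ht => hh.measurable t ht.1) hS
      (fun x => (hh.continuousOn x).mono Icc_subset_Ici_self)
      (hν.integrable_exp_singular _) (fun t ht x => hh.le_of_le hS.A_nonneg ht x) x
  intro t ht
  refine ((h1 (t + 1)) t ⟨ht, by linarith⟩).mono_of_mem_nhdsWithin ?_
  rw [← Ici_inter_Iic]
  exact Filter.inter_mem self_mem_nhdsWithin (mem_nhdsWithin_of_mem_nhds (Iic_mem_nhds (by linarith)))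

theorem intervalIntegrable_rate (hh : IsGlobalFlow A η S ν h) (hS : IsKernel A η S)
    (hν : IsDatum η ν) {s t : ℝ} (hs : 0 ≤ s) (ht : 0 ≤ t) (x : ℝ) :
    IntervalIntegrable (fun s => rate S ν (h s) x) volume s t :=
  ((hh.continuousOn_rate hS hν x).mono fun _ hu =>
    (le_min hs ht).trans hu.1).intervalIntegrable

theorem hasDerivAt (hh : IsGlobalFlow A η S ν h) (hS : IsKernel A η S) (hν : IsDatum η ν)
    {t : ℝ} (ht : 0 < t) (x : ℝ) : HasDerivAt (fun s => h s x) (rate S ν (h t) x) t := by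
  have hc := hh.continuousOn_rate hS hν x
  have h1 := intervalIntegral.integral_hasDerivAt_right
    (hh.intervalIntegrable_rate hS hν le_rfl ht.le x)
    ((hc.mono Ioi_subset_Ici_self).stronglyMeasurableAtFilter isOpen_Ioi t ht)
    (hc.continuousAt (Ici_mem_nhds ht))
  refine h1.congr_of_eventuallyEq ?_
  filter_upwards [Ici_mem_nhds ht] with s hs using hh.eq_integral s hs x

theorem abs_exp_sub_le (hh : IsGlobalFlow A η S ν h) (hS : IsKernel A η S) (hν : IsDatum η ν)
    {s t T : ℝ} (hs : s ∈ Icc 0 T) (ht : t ∈ Icc 0 T) (x : ℝ) :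
    |Real.exp (h s x) - Real.exp (h t x)| ≤
      A * (∫ y, weight η (1 + T * (A * ∫ y, Real.exp (η * y) ∂ν)) y ∂ν) * |s - t| *
        weight η (1 + T * (A * ∫ y, Real.exp (η * y) ∂ν)) x := by
  have h1 : h s x - h t x = ∫ u in t..s, rate S ν (h u) x := by
    rw [hh.eq_integral s hs.1, hh.eq_integral t ht.1, intervalIntegral.integral_interval_sub_left
      (hh.intervalIntegrable_rate hS hν le_rfl hs.1 x)
      (hh.intervalIntegrable_rate hS hν le_rfl ht.1 x)]
  have h2 : |h s x - h t x| ≤ A * weight η 1 x *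
      (∫ y, weight η (1 + T * (A * ∫ y, Real.exp (η * y) ∂ν)) y ∂ν) * |s - t| := by
    rw [h1, ← Real.norm_eq_abs]
    refine intervalIntegral.norm_integral_le_of_norm_le_const fun u hu => ?_
    have hu' := uIoc_subset_uIcc hu
    exact hh.abs_rate_le hS hν (T := T) ⟨(le_min ht.1 hs.1).trans hu'.1,
      hu'.2.trans (max_le ht.2 hs.2)⟩ x
  refine (Compton.abs_exp_sub_exp_le (hh.le_of_le hS.A_nonneg hs x)
    (hh.le_of_le hS.A_nonneg ht x)).trans ?_
  refine (mul_le_mul_of_nonneg_left h2 (Real.exp_pos _).le).trans (le_of_eq ?_)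
  rw [weight_add η 1 _ x]
  ring

/-- The rate is no longer bounded, only dominated by `weight η 1`. Multiplied by `e^h` it is still
dominated by a weight with a larger singular exponent, integrable because every exponent is allowed.
-/
theorem hasDerivAt_integral (hh : IsGlobalFlow A η S ν h) (hS : IsKernel A η S)
    (hν : IsDatum η ν) [SFinite ν] {φ : ℝ → ℝ} (hφ : AEStronglyMeasurable φ ν) {M : ℝ}
    (hM : ∀ᵐ x ∂ν, |φ x| ≤ M) {t : ℝ} (ht : 0 < t) :
    HasDerivAt (fun s => ∫ x, Real.exp (h s x) * φ x ∂ν)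
      (∫ x, Real.exp (h t x) * rate S ν (h t) x * φ x ∂ν) t := by
  set X := ∫ y, Real.exp (η * y) ∂ν
  set I := ∫ y, weight η (1 + (t + 1) * (A * X)) y ∂ν
  refine (hasDerivAt_integral_of_dominated_loc_of_deriv_le (Ioo_mem_nhds ht (lt_add_one t))
    (F := fun s x => Real.exp (h s x) * φ x)
    (F' := fun s x => Real.exp (h s x) * rate S ν (h s) x * φ x)
    (bound := fun x => A * I * weight η (1 + (t + 1) * (A * X)) x * M) ?_ ?_ ?_ ?_ ?_ ?_).2
  · filter_upwards [Ici_mem_nhds ht] with s hs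
    exact (hh.measurable s hs).exp.aestronglyMeasurable.mul hφ
  · exact (hh.integrable_exp hν ht.le).mul_bdd hφ hM
  · exact ((hh.measurable t ht.le).exp.mul
      (measurable_rate hS.measurable (hh.measurable t ht.le))).aestronglyMeasurable.mul hφ
  · filter_upwards [hM] with x hx s hs
    have hs' : s ∈ Icc 0 (t + 1) := ⟨hs.1.le, hs.2.le⟩
    have h1 := hh.abs_rate_le hS hν hs' x
    have h2 := Real.exp_le_exp.2 (hh.le_of_le hS.A_nonneg hs' x)
    rw [Real.norm_eq_abs, abs_mul, abs_mul, Real.abs_exp, weight_add]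
    have h3 : Real.exp (h s x) * |rate S ν (h s) x| ≤ A * I * (weight η 1 x *
        Real.exp ((t + 1) * (A * X) * singularWeight x)) := by
      calc _ ≤ Real.exp ((t + 1) * (A * X) * singularWeight x) * (A * weight η 1 x * I) := by
            gcongr
        _ = _ := by ring
    have h4 := (mul_nonneg (Real.exp_pos (h s x)).le (abs_nonneg _)).trans h3
    gcongr
  · exact ((hν.integrable_weight hS.η_nonneg _).const_mul _).mul_const M
  · refine ae_of_all _ fun x s hs => ?_
    exact ((hh.hasDerivAt hS hν hs.1 x).exp).mul_const _

end IsGlobalFlow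

/-! ### The Compton kernel satisfies the structural assumptions -/

section kernel

variable {β m θ δ : ℝ} {Φ : ℝ → ℝ → ℝ}

open Classical in
/-- The kernel `R`, set to zero outside of the open quadrant. -/
noncomputable def quadrantKernel (β m : ℝ) (Φ : ℝ → ℝ → ℝ) (x y : ℝ) : ℝ :=
  if 0 < x ∧ 0 < y then R β m Φ x y else 0

theorem quadrantKernel_of_pos {x y : ℝ} (hx : 0 < x) (hy : 0 < y) :
    quadrantKernel β m Φ x y = R β m Φ x y := if_pos ⟨hx, hy⟩

/-- `Φ` is arbitrary off the closed quadrant, so measurability comes from its continuity on the open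
quadrant, extended by zero. -/
theorem measurable_quadrantKernel (hΦ : IsCutoff θ δ Φ) :
    Measurable (Function.uncurry (quadrantKernel β m Φ)) := by
  classical
  have hset : MeasurableSet (Ioi (0 : ℝ) ×ˢ Ioi (0 : ℝ)) := measurableSet_Ioi.prod measurableSet_Ioi
  have hc : ContinuousOn (fun p : ℝ × ℝ => Φ p.1 p.2) (Ioi 0 ×ˢ Ioi 0) :=
    hΦ.continuousOn.mono fun p hp => ⟨⟨(mem_Ioi.1 hp.1).le, (mem_Ioi.1 hp.2).le⟩, fun h => by
      have h1 : p = (0, 0) := h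
      have h2 : (0 : ℝ) < p.1 := hp.1
      rw [h1] at h2
      exact lt_irrefl _ h2⟩
  have hP := hc.measurable_piecewise (g := fun _ => (0 : ℝ)) continuousOn_const hset
  have hE : Measurable fun p : ℝ × ℝ => (Real.exp (-β * p.1) - Real.exp (-β * p.2)) *
      ((Ioi (0 : ℝ) ×ˢ Ioi (0 : ℝ)).piecewise (fun p : ℝ × ℝ => Φ p.1 p.2) (fun _ => 0) p *
        redistribution β m p.1 p.2 / (p.1 * p.2)) :=
    (by fun_prop : Measurable fun p : ℝ × ℝ => Real.exp (-β * p.1) - Real.exp (-β * p.2)).mul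
      ((hP.mul (measurable_redistribution β m)).div (by fun_prop))
  convert hE using 1
  ext p
  by_cases hp : p ∈ Ioi (0 : ℝ) ×ˢ Ioi (0 : ℝ)
  · rw [Set.piecewise_eq_of_mem _ _ _ hp, Function.uncurry, quadrantKernel_of_pos hp.1 hp.2]
    rfl
  · rw [Set.piecewise_eq_of_notMem _ _ _ hp, Function.uncurry, quadrantKernel,
      if_neg (show ¬(0 < p.1 ∧ 0 < p.2) from hp)]
    simp

theorem R_antisymm (hΦ : IsCutoff θ δ Φ) {x y : ℝ} (hx : 0 < x) (hy : 0 < y) :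
    R β m Φ y x = -R β m Φ x y := by
  rw [R, R, truncated, truncated, hΦ.symm y hy x hx, redistribution_comm, mul_comm y x]
  ring

theorem truncated_nonneg (hΦ : IsCutoff θ δ Φ) {x y : ℝ} (hx : 0 < x) (hy : 0 < y) :
    0 ≤ truncated β m Φ x y :=
  mul_nonneg (hΦ.mem_Icc x hx.le y hy.le).1 (redistribution_nonneg _ _ _ _)

theorem R_nonneg (hβ : 0 < β) (hΦ : IsCutoff θ δ Φ) {x y : ℝ} (hx : 0 < x) (hxy : x ≤ y) :
    0 ≤ R β m Φ x y := by
  have hy := hx.trans_le hxy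
  refine mul_nonneg (sub_nonneg.2 (Real.exp_le_exp.2 (by nlinarith)))
    (div_nonneg (truncated_nonneg hΦ hx hy) (by positivity))

/-- Convexity gives `e^{-βx} - e^{-βy} ≤ e^{-βx} β(y - x)`. The exponentials combine to
`e^{β(y-x)/2}`, at most `e^{β(1-θ)y/2}` on the support: this is where the lower bound on `η` enters.
The algebraic factor is `sub_div_le_of_mem_region`. -/
theorem R_le (hβ : 0 < β) (hθ : θ ∈ Ioo (0 : ℝ) 1) (hδ : 0 < δ) (hΦ : IsCutoff θ δ Φ) {C η : ℝ}
    (hC : IsKernelConstant β m θ δ Φ C) (hη : β * (1 - θ) / 2 < η) {x y : ℝ} (hx : 0 < x)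
    (hxy : x ≤ y) : R β m Φ x y ≤
      β * (rhoStar θ δ * C / √(θ * (1 + θ))) * singularWeight x * Real.exp (η * y) := by
  have hy := hx.trans_le hxy
  have hC0 := hC.1
  have hρ := rhoStar_pos hθ hδ
  have hw := singularWeight_nonneg x
  have hθ0 := hθ.1
  by_cases h0 : Φ x y = 0
  · rw [R, truncated, h0, zero_mul, zero_div, mul_zero]
    positivity
  have hreg := mem_region_of_ne_zero hΦ hx.le hy.le h0
  have hT : truncated β m Φ x y ≤ C * Real.exp (β * (x + y) / 2) / (x + y) := by
    have := hC.2 x y hreg (fun h => hx.ne' (Prod.mk.inj h).1)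
    exact this.1.trans this.2
  have h1 : Real.exp (-β * x) - Real.exp (-β * y) ≤ Real.exp (-β * x) * (β * (y - x)) := by
    have e : Real.exp (-β * y) = Real.exp (-β * x) * Real.exp (-(β * (y - x))) := by
      rw [← Real.exp_add]
      ring_nf
    have := Real.add_one_le_exp (-(β * (y - x)))
    rw [e]
    nlinarith [Real.exp_pos (-β * x)]
  have hsub : 0 ≤ y - x := sub_nonneg.2 hxy
  have h2 : Real.exp (-β * x) * Real.exp (β * (x + y) / 2) ≤ Real.exp (η * y) := by
    rw [← Real.exp_add, Real.exp_le_exp]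
    have h3 := mul_le_of_mem_region hθ hδ hx hxy hreg
    have h4 : β * (y - x) ≤ β * ((1 - θ) * y) := by
      apply mul_le_mul_of_nonneg_left _ hβ.le
      linarith
    have h5 : β * (1 - θ) / 2 * y ≤ η * y := by gcongr
    linarith
  have h3 := sub_div_le_of_mem_region hθ hδ hx hxy hreg
  have hT0 : 0 ≤ truncated β m Φ x y := truncated_nonneg hΦ hx hy
  calc R β m Φ x y ≤ Real.exp (-β * x) * (β * (y - x)) *
        (C * Real.exp (β * (x + y) / 2) / (x + y) / (x * y)) := by
        unfold R
        gcongr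
    _ = β * C * ((y - x) / (x * y * (x + y))) *
        (Real.exp (-β * x) * Real.exp (β * (x + y) / 2)) := by
        field_simp
    _ ≤ β * C * (rhoStar θ δ / √(θ * (1 + θ)) * singularWeight x) * Real.exp (η * y) := by
        gcongr
    _ = _ := by ring

theorem isKernel_quadrantKernel (hβ : 0 < β) (hθ : θ ∈ Ioo (0 : ℝ) 1) (hδ : 0 < δ)
    (hΦ : IsCutoff θ δ Φ) {C η : ℝ} (hC : IsKernelConstant β m θ δ Φ C)
    (hη : β * (1 - θ) / 2 < η) :
    IsKernel (β * (rhoStar θ δ * C / √(θ * (1 + θ)))) η (quadrantKernel β m Φ) := by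
  have hθ0 := hθ.1
  have hA : 0 ≤ β * (rhoStar θ δ * C / √(θ * (1 + θ))) := by
    have := rhoStar_pos hθ hδ
    have := hC.1
    positivity
  have hη0 : 0 ≤ η := by
    have : 0 ≤ β * (1 - θ) / 2 := by
      have : 0 ≤ 1 - θ := by linarith [hθ.2]
      positivity
    linarith
  have hanti : ∀ x y, quadrantKernel β m Φ y x = -quadrantKernel β m Φ x y := by
    intro x y
    by_cases h : 0 < x ∧ 0 < y
    · rw [quadrantKernel_of_pos h.1 h.2, quadrantKernel_of_pos h.2 h.1, R_antisymm hΦ h.1 h.2]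
    · rw [quadrantKernel, quadrantKernel, if_neg h, if_neg fun h' => h h'.symm, neg_zero]
  have hnonneg : ∀ x y, x ≤ y → 0 ≤ quadrantKernel β m Φ x y := by
    intro x y hxy
    unfold quadrantKernel
    split_ifs with h
    · exact R_nonneg hβ hΦ h.1 hxy
    · rfl
  have hle : ∀ x y, 0 < x → x ≤ y → quadrantKernel β m Φ x y ≤
      β * (rhoStar θ δ * C / √(θ * (1 + θ))) * singularWeight x * Real.exp (η * y) := by
    intro x y hx hxy
    rw [quadrantKernel_of_pos hx (hx.trans_le hxy)]
    exact R_le hβ hθ hδ hΦ hC hη hx hxy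
  refine ⟨hA, hη0, measurable_quadrantKernel hΦ, hanti, hnonneg, hle, fun x y h => ?_, fun x => ?_⟩
  · by_contra h'
    exact h (if_neg h')
  · set A := β * (rhoStar θ δ * C / √(θ * (1 + θ)))
    by_cases hx : 0 < x
    swap
    · refine ⟨0, fun y => ?_⟩
      rw [quadrantKernel, if_neg fun h => hx h.1, abs_zero]
    have hw := singularWeight_nonneg x
    have hw' := singularWeight_nonneg (θ * x)
    have hb1 : 0 ≤ A * singularWeight x * Real.exp (η * (x / θ)) := by positivity
    have hb2 : 0 ≤ A * singularWeight (θ * x) * Real.exp (η * x) := by positivity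
    -- On the support `θx ≤ y ≤ x / θ`. The first term covers `x ≤ y`; the second covers `y ≤ x`,
    -- where the singularity is at `y ≥ θx`.
    refine ⟨A * singularWeight x * Real.exp (η * (x / θ)) +
      A * singularWeight (θ * x) * Real.exp (η * x), fun y => ?_⟩
    by_cases h : quadrantKernel β m Φ x y = 0
    · rw [h, abs_zero]
      positivity
    have hy : 0 < y := by
      by_contra hy
      exact h (if_neg fun h => hy h.2)
    have hΦ0 : Φ x y ≠ 0 := fun h0 => h (by
      rw [quadrantKernel_of_pos hx hy, R, truncated, h0]
      simp)
    rcases le_total x y with hxy | hxy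
    · rw [abs_of_nonneg (hnonneg x y hxy)]
      refine (hle x y hx hxy).trans (le_trans ?_ (le_add_of_nonneg_right hb2))
      have := mul_le_of_mem_region hθ hδ hx hxy (mem_region_of_ne_zero hΦ hx.le hy.le hΦ0)
      have : y ≤ x / θ := by rwa [le_div_iff₀ hθ0, mul_comm]
      gcongr
    · rw [← abs_neg, ← hanti, abs_of_nonneg (hnonneg y x hxy)]
      refine (hle y x hy hxy).trans (le_trans ?_ (le_add_of_nonneg_left hb1))
      rw [hΦ.symm x hx y hy] at hΦ0
      have := mul_le_of_mem_region hθ hδ hy hxy (mem_region_of_ne_zero hΦ hy.le hx.le hΦ0)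
      have := singularWeight_le (by positivity) this
      gcongr

end kernel

/-! ### The initial datum as a finite measure -/

/-- The measure with density `v₀`. -/
noncomputable def initialMeasure (v₀ : L1) : Measure ℝ :=
  halfLine.withDensity fun k => ENNReal.ofReal (v₀ k)

section initialMeasure

variable {v₀ : L1}

theorem integrable_coe (v₀ : L1) : Integrable v₀ halfLine := L1.integrable_coeFn v₀

theorem aemeasurable_ofReal (v₀ : L1) :
    AEMeasurable (fun k => ENNReal.ofReal (v₀ k)) halfLine :=
  (integrable_coe v₀).1.aemeasurable.ennreal_ofReal

instance (v₀ : L1) : IsFiniteMeasure (initialMeasure v₀) :=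
  isFiniteMeasure_withDensity_ofReal (integrable_coe v₀).2

theorem integrable_initialMeasure (h0 : ∀ᵐ k ∂halfLine, 0 ≤ v₀ k) {g : ℝ → ℝ} :
    Integrable g (initialMeasure v₀) ↔ Integrable (fun k => v₀ k * g k) halfLine := by
  rw [initialMeasure, integrable_withDensity_iff_integrable_smul₀' (aemeasurable_ofReal v₀)
    (ae_of_all _ fun _ => ENNReal.ofReal_lt_top)]
  refine integrable_congr ?_
  filter_upwards [h0] with k hk
  rw [ENNReal.toReal_ofReal hk, smul_eq_mul]

theorem integral_initialMeasure (h0 : ∀ᵐ k ∂halfLine, 0 ≤ v₀ k) (g : ℝ → ℝ) :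
    ∫ k, g k ∂initialMeasure v₀ = ∫ k, v₀ k * g k ∂halfLine := by
  rw [initialMeasure, integral_withDensity_eq_integral_toReal_smul₀ (aemeasurable_ofReal v₀)
    (ae_of_all _ fun _ => ENNReal.ofReal_lt_top)]
  refine integral_congr_ae ?_
  filter_upwards [h0] with k hk
  rw [ENNReal.toReal_ofReal hk, smul_eq_mul]

theorem initialMeasure_absolutelyContinuous (v₀ : L1) : initialMeasure v₀ ≪ halfLine :=
  withDensity_absolutelyContinuous _ _

theorem ae_pos : ∀ᵐ k ∂halfLine, (0 : ℝ) < k := ae_restrict_mem measurableSet_Ioi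

theorem isDatum_initialMeasure (h0 : ∀ᵐ k ∂halfLine, 0 ≤ v₀ k) {η : ℝ}
    (hi : ∀ r > 0, Integrable
      (fun k => v₀ k * (Real.exp (r / k ^ (3 / 2 : ℝ)) + Real.exp (η * k))) halfLine) :
    IsDatum η (initialMeasure v₀) where
  pos := (initialMeasure_absolutelyContinuous v₀).ae_le ae_pos
  integrable_exp_singular r := by
    rw [integrable_initialMeasure h0]
    -- The hypothesis concerns positive exponents only, hence the maximum with `1`.
    refine (hi (max r 1) (by positivity)).mono' ((integrable_coe v₀).1.mul
      (measurable_singularWeight.const_mul r).exp.aestronglyMeasurable) ?_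
    filter_upwards [h0, ae_pos] with k hk hpos
    rw [Real.norm_eq_abs, abs_of_nonneg (by positivity)]
    have hw : r * singularWeight k ≤ max r 1 / k ^ (3 / 2 : ℝ) := by
      rw [div_eq_mul_inv, singularWeight, abs_of_pos hpos]
      gcongr
      exact le_max_left r 1
    have := Real.exp_pos (η * k)
    have := Real.exp_le_exp.2 hw
    gcongr
    linarith
  integrable_exp := by
    rw [integrable_initialMeasure h0]
    refine (hi 1 one_pos).mono' ((integrable_coe v₀).1.mul
      (measurable_id.const_mul η).exp.aestronglyMeasurable) ?_
    filter_upwards [h0] with k hk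
    rw [Real.norm_eq_abs, abs_of_nonneg (by positivity)]
    gcongr
    linarith [Real.exp_pos (1 / k ^ (3 / 2 : ℝ))]

end initialMeasure

/-! ### The solution as a curve in `L¹` -/

section solution

variable {A η : ℝ} {S : ℝ → ℝ → ℝ} {v₀ : L1} {h : ℝ → ℝ → ℝ}

/-- The function `t ↦ v₀ e^{h t}` with values in `L¹`, for `t ≥ 0`. -/
noncomputable def solution (v₀ : L1) (h : ℝ → ℝ → ℝ)
    (hi : ∀ t ≥ 0, Integrable (fun k => v₀ k * Real.exp (h t k)) halfLine) (t : ℝ) : L1 :=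
  -- Negative times are frozen at time `0`, merely to have a total function.
  (hi (max t 0) (le_max_right t 0)).toL1 _

theorem solution_ae_eq (hi : ∀ t ≥ 0, Integrable (fun k => v₀ k * Real.exp (h t k)) halfLine)
    {t : ℝ} (ht : 0 ≤ t) : ∀ᵐ k ∂halfLine, solution v₀ h hi t k = v₀ k * Real.exp (h t k) := by
  filter_upwards [(hi (max t 0) (le_max_right t 0)).coeFn_toL1] with k hk
  rw [solution, hk, max_eq_left ht]

theorem integral_solution_mul (h0 : ∀ᵐ k ∂halfLine, 0 ≤ v₀ k)
    (hi : ∀ t ≥ 0, Integrable (fun k => v₀ k * Real.exp (h t k)) halfLine) {t : ℝ} (ht : 0 ≤ t)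
    (φ : ℝ → ℝ) : ∫ k, solution v₀ h hi t k * φ k ∂halfLine =
      ∫ k, Real.exp (h t k) * φ k ∂initialMeasure v₀ := by
  rw [integral_initialMeasure h0]
  refine integral_congr_ae ?_
  filter_upwards [solution_ae_eq hi ht] with k hk
  rw [hk, mul_assoc]

theorem norm_solution (h0 : ∀ᵐ k ∂halfLine, 0 ≤ v₀ k)
    (hi : ∀ t ≥ 0, Integrable (fun k => v₀ k * Real.exp (h t k)) halfLine) {t : ℝ} (ht : 0 ≤ t) :
    ‖solution v₀ h hi t‖ = ∫ k, Real.exp (h t k) ∂initialMeasure v₀ := by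
  rw [L1.norm_eq_integral_norm, integral_initialMeasure h0]
  refine integral_congr_ae ?_
  filter_upwards [solution_ae_eq hi ht, h0] with k hk hk0
  rw [hk, Real.norm_eq_abs, abs_of_nonneg (by positivity)]

theorem norm_eq_measureReal (h0 : ∀ᵐ k ∂halfLine, 0 ≤ v₀ k) :
    ‖v₀‖ = (initialMeasure v₀).real univ := by
  have h1 : (initialMeasure v₀).real univ = ∫ _, (1 : ℝ) ∂initialMeasure v₀ := by simp
  rw [h1, L1.norm_eq_integral_norm, integral_initialMeasure h0]
  refine integral_congr_ae ?_
  filter_upwards [h0] with k hk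
  rw [Real.norm_eq_abs, abs_of_nonneg hk, mul_one]

theorem norm_solution_sub (h0 : ∀ᵐ k ∂halfLine, 0 ≤ v₀ k)
    (hi : ∀ t ≥ 0, Integrable (fun k => v₀ k * Real.exp (h t k)) halfLine) {s t : ℝ} (hs : 0 ≤ s)
    (ht : 0 ≤ t) : ‖solution v₀ h hi s - solution v₀ h hi t‖ =
      ∫ k, |Real.exp (h s k) - Real.exp (h t k)| ∂initialMeasure v₀ := by
  rw [L1.norm_eq_integral_norm, integral_initialMeasure h0]
  refine integral_congr_ae ?_
  filter_upwards [solution_ae_eq hi hs, solution_ae_eq hi ht, h0,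
    Lp.coeFn_sub (solution v₀ h hi s) (solution v₀ h hi t)] with k hk1 hk2 hk0 hk
  rw [hk, Pi.sub_apply, hk1, hk2, ← mul_sub, Real.norm_eq_abs, abs_mul, abs_of_nonneg hk0]

theorem lipschitzOnWith_solution (h0 : ∀ᵐ k ∂halfLine, 0 ≤ v₀ k) (hS : IsKernel A η S)
    (hν : IsDatum η (initialMeasure v₀)) (hh : IsGlobalFlow A η S (initialMeasure v₀) h)
    (hi : ∀ t ≥ 0, Integrable (fun k => v₀ k * Real.exp (h t k)) halfLine) (T : ℝ) :
    ∃ K, LipschitzOnWith K (solution v₀ h hi) (Icc 0 T) := by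
  set ν := initialMeasure v₀ with hνdef
  set I := ∫ y, weight η (1 + T * (A * ∫ y, Real.exp (η * y) ∂ν)) y ∂ν with hI
  have hI0 : 0 ≤ I := integral_nonneg fun y => (weight_pos _ _ y).le
  refine ⟨Real.toNNReal (A * I * I), LipschitzOnWith.of_dist_le_mul fun s hs t ht => ?_⟩
  have hA := hS.A_nonneg
  rw [Real.coe_toNNReal _ (by positivity), dist_eq_norm, norm_solution_sub h0 hi hs.1 ht.1,
    Real.dist_eq]
  have h1 : ∫ k, |Real.exp (h s k) - Real.exp (h t k)| ∂ν ≤ ∫ k, A * I * |s - t| *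
      weight η (1 + T * (A * ∫ y, Real.exp (η * y) ∂ν)) k ∂ν :=
    integral_mono_of_nonneg (ae_of_all _ fun k => abs_nonneg _)
      ((hν.integrable_weight hS.η_nonneg _).const_mul _)
      (ae_of_all _ fun k => hh.abs_exp_sub_le hS hν hs ht k)
  rw [integral_const_mul, ← hI] at h1
  linarith

theorem continuousOn_Ici_of_lipschitzOnWith_Icc {E : Type*} [PseudoMetricSpace E] {f : ℝ → E}
    (h : ∀ T, ∃ K, LipschitzOnWith K f (Icc 0 T)) : ContinuousOn f (Ici 0) := by
  intro t ht
  obtain ⟨K, hK⟩ := h (t + 1)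
  refine (hK.continuousOn t ⟨ht, by linarith⟩).mono_of_mem_nhdsWithin ?_
  rw [← Ici_inter_Iic]
  exact Filter.inter_mem self_mem_nhdsWithin
    (mem_nhdsWithin_of_mem_nhds (Iic_mem_nhds (by linarith)))

theorem lipschitzOnWith_pairing {v : ℝ → L1} {φ : ℝ → ℝ} (hφ : ContinuousOn φ (Ici 0)) {M : ℝ}
    (hM : ∀ k ≥ 0, |φ k| ≤ M) {U : Set ℝ} {K : NNReal} (hK : LipschitzOnWith K v U) :
    ∃ K, LipschitzOnWith K (pairing v φ) U := by
  have hM0 : 0 ≤ M := (abs_nonneg _).trans (hM 0 le_rfl)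
  refine ⟨Real.toNNReal M * K, LipschitzOnWith.of_dist_le_mul fun s hs t ht => ?_⟩
  have hm : AEStronglyMeasurable φ halfLine :=
    (hφ.mono Ioi_subset_Ici_self).aestronglyMeasurable measurableSet_Ioi
  have hb : ∀ᵐ k ∂halfLine, ‖φ k‖ ≤ M := by
    filter_upwards [ae_pos] with k hk using hM k hk.le
  have hi : ∀ t, Integrable (fun k => v t k * φ k) halfLine := fun t =>
    (integrable_coe (v t)).mul_bdd hm hb
  rw [Real.dist_eq, pairing, pairing, ← integral_sub (hi s) (hi t), NNReal.coe_mul,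
    Real.coe_toNNReal _ hM0, mul_assoc]
  have h1 : |∫ k, (v s k * φ k - v t k * φ k) ∂halfLine| ≤ M * dist (v s) (v t) := by
    rw [dist_eq_norm, L1.norm_eq_integral_norm, ← integral_const_mul, ← Real.norm_eq_abs]
    refine norm_integral_le_of_norm_le ((integrable_coe _).norm.const_mul M) ?_
    filter_upwards [hb, Lp.coeFn_sub (v s) (v t)] with k hk hsub
    rw [hsub, Pi.sub_apply, ← sub_mul, norm_mul, mul_comm]
    gcongr
  exact h1.trans (mul_le_mul_of_nonneg_left (hK.dist_le_mul s hs t ht) hM0)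

theorem rate_eq_integral_solution (h0 : ∀ᵐ k ∂halfLine, 0 ≤ v₀ k)
    (hi : ∀ t ≥ 0, Integrable (fun k => v₀ k * Real.exp (h t k)) halfLine) {t : ℝ} (ht : 0 ≤ t)
    (x : ℝ) : rate S (initialMeasure v₀) (h t) x =
      ∫ y, S x y * solution v₀ h hi t y ∂halfLine := by
  rw [rate, integral_initialMeasure h0]
  refine integral_congr_ae ?_
  filter_upwards [solution_ae_eq hi ht] with k hk
  rw [hk]
  ring

/-- By the pointwise bound, `|S|` times the two densities is at most a product of integrable
functions of one variable. -/
theorem integrable_kernel_mul_solution (h0 : ∀ᵐ k ∂halfLine, 0 ≤ v₀ k) (hS : IsKernel A η S)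
    (hν : IsDatum η (initialMeasure v₀)) (hh : IsGlobalFlow A η S (initialMeasure v₀) h)
    (hi : ∀ t ≥ 0, Integrable (fun k => v₀ k * Real.exp (h t k)) halfLine) {t : ℝ} (ht : 0 ≤ t)
    {ψ : ℝ × ℝ → ℝ} (hψ : AEStronglyMeasurable ψ (halfLine.prod halfLine)) {M : ℝ}
    (hM : ∀ᵐ p ∂halfLine.prod halfLine, |ψ p| ≤ M) :
    Integrable (fun p : ℝ × ℝ => S p.1 p.2 *
      (solution v₀ h hi t p.1 * solution v₀ h hi t p.2) * ψ p) (halfLine.prod halfLine) := by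
  set r := t * (A * ∫ y, Real.exp (η * y) ∂initialMeasure v₀)
  have hw : Integrable (fun k => v₀ k * weight η (1 + r) k) halfLine :=
    (integrable_initialMeasure h0).1 (hν.integrable_weight hS.η_nonneg _)
  have hv := (integrable_coe (solution v₀ h hi t)).1
  refine Integrable.mul_bdd (c := M) (((hw.mul_prod hw).const_mul A).mono'
    (hS.measurable.aestronglyMeasurable.mul (hv.comp_fst.mul hv.comp_snd)) ?_) hψ hM
  have key : ∀ᵐ k ∂halfLine, 0 ≤ v₀ k ∧
      |solution v₀ h hi t k| ≤ v₀ k * Real.exp (r * singularWeight k) := by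
    filter_upwards [solution_ae_eq hi ht, h0] with k hk hk0
    rw [hk, abs_of_nonneg (by positivity)]
    exact ⟨hk0, mul_le_mul_of_nonneg_left (Real.exp_le_exp.2 (hh.le t ht k)) hk0⟩
  filter_upwards [Measure.quasiMeasurePreserving_fst.ae key,
    Measure.quasiMeasurePreserving_snd.ae key] with p ⟨h01, h1⟩ ⟨h02, h2⟩
  rw [norm_mul, norm_mul, Real.norm_eq_abs, Real.norm_eq_abs, Real.norm_eq_abs]
  calc |S p.1 p.2| * (|solution v₀ h hi t p.1| * |solution v₀ h hi t p.2|) ≤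
      |S p.1 p.2| * (v₀ p.1 * Real.exp (r * singularWeight p.1) *
        (v₀ p.2 * Real.exp (r * singularWeight p.2))) := by gcongr
    _ = v₀ p.1 * v₀ p.2 * (|S p.1 p.2| * (Real.exp (r * singularWeight p.1) *
        Real.exp (r * singularWeight p.2))) := by ring
    _ ≤ v₀ p.1 * v₀ p.2 * (A * (weight η (1 + r) p.1 * weight η (1 + r) p.2)) := by
        exact mul_le_mul_of_nonneg_left (hS.abs_mul_exp_le r p.1 p.2) (mul_nonneg h01 h02)
    _ = _ := by ring

end solution

/-! ### The weak formulation -/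

section

variable {β m A η : ℝ} {Φ : ℝ → ℝ → ℝ} {v₀ : L1} {h : ℝ → ℝ → ℝ}

theorem ae_quadrantKernel_eq {x : ℝ} (hx : 0 < x) :
    ∀ᵐ y ∂halfLine, quadrantKernel β m Φ x y = R β m Φ x y := by
  filter_upwards [ae_pos] with y hy using quadrantKernel_of_pos hx hy

theorem hasDerivAt_pairing (h0 : ∀ᵐ k ∂halfLine, 0 ≤ v₀ k)
    (hS : IsKernel A η (quadrantKernel β m Φ)) (hν : IsDatum η (initialMeasure v₀))
    (hh : IsGlobalFlow A η (quadrantKernel β m Φ) (initialMeasure v₀) h)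
    (hi : ∀ t ≥ 0, Integrable (fun k => v₀ k * Real.exp (h t k)) halfLine)
    {φ : ℝ → ℝ} (hφ : ContinuousOn φ (Ici 0)) {M : ℝ} (hM : ∀ k ≥ 0, |φ k| ≤ M) {t : ℝ}
    (ht : 0 < t) :
    Integrable (weakIntegrand β m Φ (solution v₀ h hi t) φ) (halfLine.prod halfLine) ∧
      HasDerivAt (pairing (solution v₀ h hi) φ)
        (1 / 2 * ∫ p, weakIntegrand β m Φ (solution v₀ h hi t) φ p ∂(halfLine.prod halfLine)) t := by
  set S := quadrantKernel β m Φ with hSdef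
  set w := solution v₀ h hi t with hw
  have hm : AEStronglyMeasurable φ halfLine :=
    (hφ.mono Ioi_subset_Ici_self).aestronglyMeasurable measurableSet_Ioi
  have hb : ∀ᵐ k ∂halfLine, |φ k| ≤ M := by
    filter_upwards [ae_pos] with k hk using hM k hk.le
  have hb₁ := (Measure.quasiMeasurePreserving_fst (μ := halfLine) (ν := halfLine)).ae hb
  have hb₂ := (Measure.quasiMeasurePreserving_snd (μ := halfLine) (ν := halfLine)).ae hb
  have hF : Integrable (fun p : ℝ × ℝ => S p.1 p.2 * (w p.1 * w p.2) * φ p.1)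
      (halfLine.prod halfLine) :=
    integrable_kernel_mul_solution h0 hS hν hh hi ht.le hm.comp_fst hb₁
  have hG : Integrable (fun p : ℝ × ℝ => S p.1 p.2 * (w p.1 * w p.2) * (φ p.1 - φ p.2))
      (halfLine.prod halfLine) :=
    integrable_kernel_mul_solution h0 hS hν hh hi ht.le (hm.comp_fst.sub hm.comp_snd) (M := M + M)
      (by
        filter_upwards [hb₁, hb₂] with p h1 h2
        exact (abs_sub _ _).trans (add_le_add h1 h2))
  have hae : (fun p : ℝ × ℝ => S p.1 p.2 * (w p.1 * w p.2) * (φ p.1 - φ p.2)) =ᵐ[halfLine.prod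
      halfLine] weakIntegrand β m Φ w φ := by
    filter_upwards [(Measure.quasiMeasurePreserving_fst (μ := halfLine) (ν := halfLine)).ae ae_pos,
      (Measure.quasiMeasurePreserving_snd (μ := halfLine) (ν := halfLine)).ae ae_pos] with p h1 h2
    rw [hSdef, quadrantKernel_of_pos h1 h2, weakIntegrand]
    ring
  refine ⟨hG.congr hae, ?_⟩
  have hac := initialMeasure_absolutelyContinuous v₀
  have hd := hh.hasDerivAt_integral hS hν (hm.mono_ac hac) (hac.ae_le hb) ht
  have hval : ∫ x, Real.exp (h t x) * rate S (initialMeasure v₀) (h t) x * φ x ∂initialMeasure v₀ =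
      1 / 2 * ∫ p, weakIntegrand β m Φ w φ p ∂(halfLine.prod halfLine) := by
    rw [← integral_congr_ae hae, ← integral_const_mul]
    -- The two integrands have the same symmetrization, by antisymmetry of the kernel.
    have h1 : ∫ p, S p.1 p.2 * (w p.1 * w p.2) * φ p.1 ∂(halfLine.prod halfLine) =
        ∫ p, 1 / 2 * (S p.1 p.2 * (w p.1 * w p.2) * (φ p.1 - φ p.2)) ∂(halfLine.prod halfLine) :=
      integral_prod_eq_of_symm hF (hG.const_mul (1 / 2)) (ae_of_all _ fun p => by
        simp only [Prod.fst_swap, Prod.snd_swap, hS.antisymm p.1 p.2]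
        ring)
    rw [← h1, integral_prod _ hF, integral_initialMeasure h0]
    refine integral_congr_ae ?_
    filter_upwards [solution_ae_eq hi ht.le] with x hx
    rw [rate_eq_integral_solution h0 hi ht.le, ← hw, ← mul_assoc, ← mul_assoc, ← hx, ← hw, mul_assoc,
      mul_comm _ (φ x), ← mul_assoc, ← integral_const_mul]
    refine integral_congr_ae (ae_of_all _ fun y => ?_)
    simp only
    ring
  rw [← hval]
  refine hd.congr_of_eventuallyEq ?_
  filter_upwards [Ici_mem_nhds ht] with s hs
  exact integral_solution_mul h0 hi hs φ

theorem isWeakSolution_solution (h0 : ∀ᵐ k ∂halfLine, 0 ≤ v₀ k)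
    (hS : IsKernel A η (quadrantKernel β m Φ)) (hν : IsDatum η (initialMeasure v₀))
    (hh : IsGlobalFlow A η (quadrantKernel β m Φ) (initialMeasure v₀) h)
    (hi : ∀ t ≥ 0, Integrable (fun k => v₀ k * Real.exp (h t k)) halfLine)
    (hinit : solution v₀ h hi 0 = v₀) :
    IsWeakSolution β m Φ v₀ (solution v₀ h hi) where
  continuousOn φ hφ := by
    obtain ⟨hc, M, hM⟩ := hφ
    refine continuousOn_Ici_of_lipschitzOnWith_Icc fun T => ?_
    obtain ⟨K, hK⟩ := lipschitzOnWith_solution h0 hS hν hh hi T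
    exact lipschitzOnWith_pairing hc hM hK
  initial φ _ := by rw [pairing, hinit]
  lipschitz φ hφ _ T _ := by
    obtain ⟨hc, ⟨M, hM⟩, _⟩ := hφ
    obtain ⟨K, hK⟩ := lipschitzOnWith_solution h0 hS hν hh hi T
    exact lipschitzOnWith_pairing hc.continuousOn hM hK
  equation φ hφ _ := by
    obtain ⟨hc, ⟨M, hM⟩, _⟩ := hφ
    filter_upwards [ae_restrict_mem measurableSet_Ioi] with t ht
    exact hasDerivAt_pairing h0 hS hν hh hi hc.continuousOn hM ht

end

end Compton

/-! ### The theorem -/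

theorem theorem1p3 (β m θ δ : ℝ) (hβ : 0 < β) (hm : 0 < m) (hθ : θ ∈ Set.Ioo (0 : ℝ) 1)
    (hδ : 0 < δ) (Φ : ℝ → ℝ → ℝ) (hΦ : Compton.IsCutoff θ δ Φ) :
    (∃ C, Compton.IsKernelConstant β m θ δ Φ C) ∧
    ∀ (v₀ : Compton.L1) (η : ℝ),
      (∀ᵐ k ∂Compton.halfLine, 0 ≤ v₀ k) →
      β * (1 - θ) / 2 < η →
      (∀ r > 0, MeasureTheory.Integrable
        (fun k => v₀ k * (Real.exp (r / k ^ (3 / 2 : ℝ)) + Real.exp (η * k))) Compton.halfLine) →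
      ∃ v : ℝ → Compton.L1,
        ContinuousOn v (Set.Ici 0) ∧
        v 0 = v₀ ∧
        (∀ t ≥ 0, ∀ᵐ k ∂Compton.halfLine, 0 ≤ v t k) ∧
        Compton.IsWeakSolution β m Φ v₀ v ∧
        (∀ t > 0, ∀ᵐ k ∂Compton.halfLine,
          (∀ s ∈ Set.Icc 0 t, MeasureTheory.Integrable
            (fun k' => Compton.R β m Φ k k' * v s k') Compton.halfLine) ∧
          IntervalIntegrable
            (fun s => ∫ k', Compton.R β m Φ k k' * v s k' ∂Compton.halfLine)
            MeasureTheory.volume 0 t ∧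
          v t k = v₀ k * Real.exp
            (∫ s in (0 : ℝ)..t, ∫ k', Compton.R β m Φ k k' * v s k' ∂Compton.halfLine)) ∧
        (∀ t > 0, ‖v t‖ = ‖v₀‖) ∧
        ∀ C, Compton.IsKernelConstant β m θ δ Φ C →
          ∀ t > 0, ∀ᵐ k ∂Compton.halfLine,
            v t k ≤ v₀ k * Real.exp
              (t * (β * (Compton.rhoStar θ δ * C / √(θ * (1 + θ)) * Compton.expMoment η v₀)) /
                k ^ (3 / 2 : ℝ)) := by
  open Compton in
  obtain ⟨C₁, hC₁⟩ := exists_isKernelConstant (m := m) hβ hm hθ hΦ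
  refine ⟨⟨C₁, hC₁⟩, fun v₀ η h0 hη hdatum => ?_⟩
  have hS := isKernel_quadrantKernel hβ hθ hδ hΦ hC₁ hη
  have hν := isDatum_initialMeasure h0 hdatum
  obtain ⟨h, hh⟩ := exists_isGlobalFlow hS hν
  have hi : ∀ t ≥ 0, Integrable (fun k => v₀ k * Real.exp (h t k)) halfLine := fun t ht =>
    (integrable_initialMeasure h0).1 (hh.integrable_exp hν ht)
  have hinit : solution v₀ h hi 0 = v₀ := by
    refine Lp.ext ?_
    filter_upwards [solution_ae_eq hi le_rfl] with k hk
    rw [hk, hh.eq_integral 0 le_rfl, intervalIntegral.integral_same, Real.exp_zero, mul_one]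
  have hrate : ∀ s ≥ 0, ∀ k > 0, ∫ k', R β m Φ k k' * solution v₀ h hi s k' ∂halfLine =
      rate (quadrantKernel β m Φ) (initialMeasure v₀) (h s) k := by
    intro s hs k hk
    rw [rate_eq_integral_solution h0 hi hs]
    refine integral_congr_ae ?_
    filter_upwards [ae_quadrantKernel_eq (β := β) (m := m) (Φ := Φ) hk] with k' hk'
    rw [hk']
  refine ⟨solution v₀ h hi,
    continuousOn_Ici_of_lipschitzOnWith_Icc (lipschitzOnWith_solution h0 hS hν hh hi), hinit,
    fun t ht => ?_, isWeakSolution_solution h0 hS hν hh hi hinit, fun t ht => ?_, fun t ht => ?_,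
    fun C hC t ht => ?_⟩
  · filter_upwards [solution_ae_eq hi ht, h0] with k hk hk0
    rw [hk]
    positivity
  · filter_upwards [solution_ae_eq hi ht.le, ae_pos] with k hk hpos
    refine ⟨fun s _ => ?_, ?_, ?_⟩
    · refine (hS.integrable_row (integrable_coe (solution v₀ h hi s)) k).congr ?_
      filter_upwards [ae_quadrantKernel_eq (β := β) (m := m) (Φ := Φ) hpos] with k' hk'
      rw [hk']
    · refine (hh.intervalIntegrable_rate hS hν le_rfl ht.le k).congr fun s hs => ?_
      rw [uIoc_of_le ht.le] at hs
      exact (hrate s hs.1.le k hpos).symm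
    · rw [hk, hh.eq_integral t ht.le]
      congr 2
      refine intervalIntegral.integral_congr fun s hs => ?_
      rw [uIcc_of_le ht.le] at hs
      exact (hrate s hs.1 k hpos).symm
  · rw [norm_solution h0 hi ht.le, hh.mass t ht.le, norm_eq_measureReal h0]
  · have hSC := isKernel_quadrantKernel hβ hθ hδ hΦ hC hη
    have hX : expMoment η v₀ = ∫ k, Real.exp (η * k) ∂initialMeasure v₀ := by
      rw [integral_initialMeasure h0, expMoment]
      simp_rw [mul_comm]
    filter_upwards [solution_ae_eq hi ht.le, h0, ae_pos] with k hk hk0 hpos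
    rw [hk]
    refine mul_le_mul_of_nonneg_left (Real.exp_le_exp.2 ?_) hk0
    rw [hh.eq_integral t ht.le]
    have hle : ∀ s ∈ Icc 0 t, rate (quadrantKernel β m Φ) (initialMeasure v₀) (h s) k ≤
        β * (rhoStar θ δ * C / √(θ * (1 + θ))) * singularWeight k * expMoment η v₀ := by
      intro s hs
      refine (hSC.rate_le (hh.integrable_exp hν hs.1)
        (hh.integrable_exp_mul_exp hν hS.η_nonneg hs.1) k).trans ?_
      rw [hX]
      exact mul_le_mul_of_nonneg_left (hh.moment_le s hs.1)
        (mul_nonneg hSC.A_nonneg (singularWeight_nonneg k))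
    have h1 := intervalIntegral.integral_mono_on ht.le
      (hh.intervalIntegrable_rate hS hν le_rfl ht.le k) intervalIntegrable_const hle
    rw [intervalIntegral.integral_const, sub_zero, smul_eq_mul] at h1
    refine h1.trans (le_of_eq ?_)
    rw [singularWeight, abs_of_pos hpos, div_eq_mul_inv]
    ring
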